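/- **Conventions.** A subgroup $H$ of a group $G$ is *dense* if for each $g\in G$ there is $n\ge 1$ with $g^n\in H$. A group is *minimax* if it has a finite subnormal series from $1$ to the group whose factors are cyclic or quasi-cyclic (Prüfer $p$-groups). Modules are left modules (right modules are handled in the same way via $g\mapsto g^{-1}$). For a normal subgroup $K$ of $N$ and an $N$-invariant two-sided ideal $I$ of $kK$ put $I^\dagger=N\cap(1+I)$, a normal subgroup of $N$ contained in $K$. The ideal $I$ is *$N$-large* if $I\ne kK$, $|K/I^\dagger|<\infty$, and $I=(kF\cap I)\,kK$ for some normal subgroup $F$ of $N$ with $I^\dagger\le F\le K$ and $F/I^\dagger$ abelian. A $kN$-module $W$ is *$kK$-torsion-free* if $xw=0$ with $x\in kK$, $w\in W$ implies $x=0$ or $w=0$. For a module $M$ over a commutative ring $R$, let $\mu_R(M)$ be the set of minimal elements of the support of $M$. For an abelian group $A$, write $P\approx Q$ for prime ideals $P,Q$ of $kA$ if $P\cap kB=Q\cap kB$ for some finitely generated dense subgroup $B\le A$, and let $[P]$ be the class of $P$. For a dense subgroup $C\le A$ and a set $\mu$ of prime ideals of $kC$ let $[\mu]_{kA}=\{[Q]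 : Q \text{ a prime ideal of } kA,\ Q\cap kC\in\mu\}$. **Statement.** Let $N$ be a torsion-free minimax nilpotent group, $K$ a normal subgroup of $N$ with $N/K$ torsion-free abelian, $k$ a field of characteristic $0$, and $W\ne 0$ a $kK$-torsion-free $kN$-module. Let $I$ be an $N$-large ideal of $kK$, and let $A$ be a torsion-free characteristic central subgroup of finite index in $N/I^\dagger$. Call a dense subgroup $L\le N$ *admissible* if $K\le L$ and $L/K$ is finitely generated. For $a\in W$ and admissible $L$ put $M_{a,L}=kLa/I\,kLa$, on which $L/I^\dagger$, hence $A\cap L/I^\dagger$, acts. Denote by $A_L$ a finitely generated dense subgroup of $A\cap L/I^\dagger$ such that for every subgroup $X$ of finite index in $A_L$ the map $P\mapsto P\cap kX$ is a bijection from the set of prime ideals of $kA_L$ minimal over $\mathrm{Ann}_{kA_L}(M_{a,L})$ onto the set of prime ideals of $kX$ minimal over $\mathrm{Ann}_{kX}(M_{a,L})$. Then there is a nonzero cyclic $kN$-submodule $V$ of $W$ such that: 1. for every $0\ne a\in V$ and every admissible $L$ a subgroup $A_L$ as above exists; 2. for all nonzero $a,b\in V$, all admissible $L,M$, and all subgroups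 $A_L$ (for $a,L$) and $A_M$ (for $b,M$) as above, $$[\mu_{kA_L}(M_{a,L})]_{kA}=[\mu_{kA_M}(M_{b,M})]_{kA};$$ 3. consequently there is exactly one finite set $M_{kA}(V/VI)$ of equivalence classes of prime ideals of $kA$ such that $M_{kA}(V/VI)=[\mu_{kA_L}(M_{a,L})]_{kA}$ for all nonzero $a\in V$, all admissible $L$ and all $A_L$ as above. -/

import Mathlib

open scoped IsMulCommutative commutatorElement

/-! ### Groups -/

/-- Every element of finite order is trivial. -/
def GroupIsTorsionFree (G : Type*) [Group G] : Prop :=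
  ∀ g : G, IsOfFinOrder g → g = 1

/-- A quasi-cyclic group: a Prüfer `p`-group, i.e. a group isomorphic to the group of all complex
roots of unity of `p`-power order, for some prime `p`. -/
def IsQuasicyclic (G : Type*) [Group G] : Prop :=
  ∃ (p : ℕ) (_ : Fact p.Prime), Nonempty (G ≃* CommGroup.primaryComponent ℂˣ p)

/-- A group is minimax if it has a finite (subnormal) series
`1 = H 0 ≤ H 1 ≤ ... ≤ H n = G` each of whose factors is cyclic or quasi-cyclic. -/
def IsMinimaxGroup (G : Type*) [Group G] : Prop :=
  ∃ (n : ℕ) (H : ℕ → Subgroup G), H 0 = ⊥ ∧ H n = ⊤ ∧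
    ∀ i < n, H i ≤ H (i + 1) ∧
      ∃ _ : ((H i).subgroupOf (H (i + 1))).Normal,
        IsCyclic (↥(H (i + 1)) ⧸ (H i).subgroupOf (H (i + 1))) ∨
        IsQuasicyclic (↥(H (i + 1)) ⧸ (H i).subgroupOf (H (i + 1)))

/-- `H` is dense in `G` if every element of `G` has a positive power in `H`. -/
def IsDenseSubgroup {G : Type*} [Group G] (H : Subgroup G) : Prop :=
  ∀ g : G, ∃ n : ℕ, 0 < n ∧ g ^ n ∈ H

/-! ### Group rings, minimal primes and equivalence classes of primes -/

section Commutative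

variable {k : Type*} [Field k]

/-- For an abelian group `Γ` and a `kΓ`-module `M` (given as a representation `σ` of `Γ` on `M`),
the set of minimal elements of the support of `M`. -/
def minimalSupport {Γ M : Type*} [CommGroup Γ] [AddCommGroup M] [Module k M]
    (σ : Representation k Γ M) : Set (PrimeSpectrum (MonoidAlgebra k Γ)) :=
  {P | Minimal (fun Q => Q ∈ Module.support (MonoidAlgebra k Γ) σ.asModule) P}

/-- For an abelian group `Γ` and a `kΓ`-module `M` (given as a representation `σ` of `Γ` on `M`),
the set of prime ideals of `kΓ` that are minimal over the annihilator of `M`. -/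
def minimalOverAnnihilator {Γ M : Type*} [CommGroup Γ] [AddCommGroup M] [Module k M]
    (σ : Representation k Γ M) : Set (Ideal (MonoidAlgebra k Γ)) :=
  (Module.annihilator (MonoidAlgebra k Γ) σ.asModule).minimalPrimes

/-- The condition on a subgroup `C` of the abelian group `Γ` acting on `M`: it is finitely
generated and dense in `Γ`, and for every subgroup `X` of finite index in `C` the map
`P ↦ P ∩ kX` is a bijection from the primes of `kC` minimal over `Ann_{kC} M` to the primes of
`kX` minimal over `Ann_{kX} M`. -/
structure IsStableSubgroup {Γ M : Type*} [CommGroup Γ] [AddCommGroup M] [Module k M]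
    (σ : Representation k Γ M) (C : Subgroup Γ) : Prop where
  fg : C.FG
  dense : IsDenseSubgroup C
  bijOn : ∀ X : Subgroup C, X.FiniteIndex →
    Set.BijOn (Ideal.comap (MonoidAlgebra.mapDomainRingHom k X.subtype))
      (minimalOverAnnihilator (σ.comp C.subtype))
      (minimalOverAnnihilator ((σ.comp C.subtype).comp X.subtype))

/-- `P ≈ Q` if `P ∩ kB = Q ∩ kB` for some finitely generated dense subgroup `B` of `A`. -/
def PrimesEquivalent {A : Type*} [CommGroup A] (P Q : PrimeSpectrum (MonoidAlgebra k A)) : Prop :=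
  ∃ B : Subgroup A, B.FG ∧ IsDenseSubgroup B ∧
    P.asIdeal.comap (MonoidAlgebra.mapDomainRingHom k B.subtype) =
      Q.asIdeal.comap (MonoidAlgebra.mapDomainRingHom k B.subtype)

/-- The class `[P]` of all prime ideals of `kA` equivalent to `P`. -/
def primeClass {A : Type*} [CommGroup A] (P : PrimeSpectrum (MonoidAlgebra k A)) :
    Set (PrimeSpectrum (MonoidAlgebra k A)) :=
  {Q | PrimesEquivalent P Q}

/-- For a homomorphism `ι : B → A` of abelian groups (in use: the inclusion of a dense subgroup)
and a set `S` of primes of `kB`, the set `[S]_{kA}` of the classes `[Q]`, where `Q` is a prime of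
`kA` with `Q ∩ kB ∈ S`. -/
def classesOver {A B : Type*} [CommGroup A] [CommGroup B] (ι : B →* A)
    (S : Set (PrimeSpectrum (MonoidAlgebra k B))) :
    Set (Set (PrimeSpectrum (MonoidAlgebra k A))) :=
  {c | ∃ P ∈ S, ∃ Q : PrimeSpectrum (MonoidAlgebra k A),
    PrimeSpectrum.comap (MonoidAlgebra.mapDomainRingHom k ι) Q = P ∧ c = primeClass Q}

end Commutative

section GroupRing

variable {N : Type*} [Group N]

/-- The group ring `kH` of a subgroup `H ≤ N`, as a subalgebra of `kN`. -/
noncomputable def groupSubalgebra (k : Type*) [Field k] (H : Subgroup N) :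
    Subalgebra k (MonoidAlgebra k N) :=
  (MonoidAlgebra.mapDomainAlgHom k k H.subtype).range

theorem of_mem_groupSubalgebra {k : Type*} [Field k] {H : Subgroup N} {h : N} (hh : h ∈ H) :
    MonoidAlgebra.of k N h ∈ groupSubalgebra k H :=
  ⟨MonoidAlgebra.of k H ⟨h, hh⟩, by simp [MonoidAlgebra.of_apply]⟩

/-- An `N`-invariant two-sided ideal of the group ring `kK`, where `K ≤ N`. -/
structure InvariantIdeal (k : Type*) [Field k] (K : Subgroup N) where
  /-- the underlying subspace of `kK ≤ kN` -/
  carrier : Submodule k (MonoidAlgebra k N)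
  le_groupRing : carrier ≤ (groupSubalgebra k K).toSubmodule
  mul_mem_left : ∀ r ∈ groupSubalgebra k K, ∀ x ∈ carrier, r * x ∈ carrier
  mul_mem_right : ∀ r ∈ groupSubalgebra k K, ∀ x ∈ carrier, x * r ∈ carrier
  conj_mem : ∀ g : N, ∀ x ∈ carrier,
    MonoidAlgebra.of k N g * x * MonoidAlgebra.of k N g⁻¹ ∈ carrier

namespace InvariantIdeal

variable {k : Type*} [Field k] {K : Subgroup N}

theorem of_mul_mem (I : InvariantIdeal k K) {g : N} (hg : g ∈ K) {x : MonoidAlgebra k N}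
    (hx : x ∈ I.carrier) : MonoidAlgebra.of k N g * x ∈ I.carrier :=
  I.mul_mem_left _ (of_mem_groupSubalgebra hg) x hx

theorem mem_of_of_sub_one_mem (I : InvariantIdeal k K) {g : N}
    (hg : MonoidAlgebra.of k N g - 1 ∈ I.carrier) : g ∈ K := by
  have h1 : MonoidAlgebra.of k N g ∈ groupSubalgebra k K := by
    have h2 : MonoidAlgebra.of k N g - 1 ∈ groupSubalgebra k K := I.le_groupRing hg
    simpa using add_mem h2 (one_mem (groupSubalgebra k K))
  obtain ⟨y, hy⟩ := h1
  by_contra hgK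
  have h3 : (MonoidAlgebra.mapDomain K.subtype y).coeff g = 0 := by
    apply Finsupp.mapDomain_of_notMem_range
    rintro ⟨z, hz⟩
    exact hgK (hz ▸ z.2)
  have h4 : (MonoidAlgebra.mapDomain K.subtype y).coeff g = 1 := by
    have h5 : MonoidAlgebra.mapDomain K.subtype y = MonoidAlgebra.of k N g := hy
    rw [h5, MonoidAlgebra.of_apply]
    exact Finsupp.single_eq_same
  exact one_ne_zero (h4.symm.trans h3)

/-- `I† = N ∩ (1 + I)`. -/
def dagger (I : InvariantIdeal k K) : Subgroup N where
  carrier := {g | MonoidAlgebra.of k N g - 1 ∈ I.carrier}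
  one_mem' := by
    show MonoidAlgebra.of k N 1 - 1 ∈ I.carrier
    rw [map_one, sub_self]; exact zero_mem _
  mul_mem' := by
    intro a b ha hb
    have haK := I.mem_of_of_sub_one_mem ha
    have h := add_mem (I.of_mul_mem haK hb) ha
    have e : MonoidAlgebra.of k N (a * b) - 1 =
        MonoidAlgebra.of k N a * (MonoidAlgebra.of k N b - 1) +
          (MonoidAlgebra.of k N a - 1) := by
      rw [map_mul]; noncomm_ring
    show MonoidAlgebra.of k N (a * b) - 1 ∈ I.carrier
    rw [e]; exact h
  inv_mem' := by
    intro a ha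
    have haK := I.mem_of_of_sub_one_mem ha
    have h := neg_mem (I.of_mul_mem (inv_mem haK) ha)
    have e : MonoidAlgebra.of k N a⁻¹ - 1 =
        -(MonoidAlgebra.of k N a⁻¹ * (MonoidAlgebra.of k N a - 1)) := by
      rw [mul_sub, ← map_mul, inv_mul_cancel, map_one, mul_one, neg_sub]
    show MonoidAlgebra.of k N a⁻¹ - 1 ∈ I.carrier
    rw [e]; exact h

theorem dagger_le (I : InvariantIdeal k K) : I.dagger ≤ K :=
  fun _ hg => I.mem_of_of_sub_one_mem hg

instance dagger_normal (I : InvariantIdeal k K) : I.dagger.Normal where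
  conj_mem := by
    intro n hn g
    have h := I.conj_mem g _ hn
    have e : MonoidAlgebra.of k N (g * n * g⁻¹) - 1 =
        MonoidAlgebra.of k N g * (MonoidAlgebra.of k N n - 1) * MonoidAlgebra.of k N g⁻¹ := by
      rw [mul_sub, sub_mul, ← map_mul, ← map_mul, mul_one, ← map_mul, mul_inv_cancel, map_one]
    show MonoidAlgebra.of k N (g * n * g⁻¹) - 1 ∈ I.carrier
    rw [e]; exact h

/-- The `N`-invariant ideal `I` of `kK` is `N`-large: it is proper (equivalently `k / (k ∩ I)` is
a field), `K / I†` is finite, and `I = (kF ∩ I) kK` for some `N`-invariant subgroup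
`I† ≤ F ≤ K` with `F / I†` abelian. -/
structure IsLarge (I : InvariantIdeal k K) : Prop where
  one_notMem : (1 : MonoidAlgebra k N) ∉ I.carrier
  finite : Finite (↥K ⧸ I.dagger.subgroupOf K)
  generated : ∃ F : Subgroup N, F.Normal ∧ I.dagger ≤ F ∧ F ≤ K ∧
    (∀ x ∈ F, ∀ y ∈ F, ⁅x, y⁆ ∈ I.dagger) ∧
    I.carrier =
      ((groupSubalgebra k F).toSubmodule ⊓ I.carrier) * (groupSubalgebra k K).toSubmodule

end InvariantIdeal

/-! ### Modules over the group ring -/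

section Module

variable {k : Type*} [Field k] {W : Type*} [AddCommGroup W] [Module k W]
  [Module (MonoidAlgebra k N) W] [IsScalarTower k (MonoidAlgebra k N) W]

variable (W) in
/-- The `kN`-module `W` is `kH`-torsion-free. -/
def IsTorsionFreeOver (k : Type*) [Field k] [Module (MonoidAlgebra k N) W] (H : Subgroup N) :
    Prop :=
  ∀ x ∈ groupSubalgebra k H, ∀ w : W, x • w = 0 → x = 0 ∨ w = 0

/-- The cyclic `kL`-submodule of `W` generated by `a`. -/
noncomputable def cyclicSub (L : Subgroup N) (a : W) : Submodule k W :=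
  (groupSubalgebra k L).toSubmodule • Submodule.span k {a}

variable {K : Subgroup N} (I : InvariantIdeal k K) (L : Subgroup N) (a : W)

/-- The subspace `I · U` of `U`, where `U` is the `kL`-submodule generated by `a`. -/
noncomputable def idealSub : Submodule k ↥(cyclicSub (k := k) L a) :=
  (I.carrier • cyclicSub (k := k) L a).submoduleOf (cyclicSub L a)

/-- The quotient `U / I U`, where `U` is the `kL`-submodule of `W` generated by `a`. -/
abbrev CyclicQuotient : Type _ := ↥(cyclicSub (k := k) L a) ⧸ idealSub I L a

theorem of_smul_mem_cyclicSub {l : N} (hl : l ∈ L) {u : W} (hu : u ∈ cyclicSub (k := k) L a) :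
    MonoidAlgebra.of k N l • u ∈ cyclicSub (k := k) L a := by
  refine Submodule.smul_induction_on hu (fun r hr w hw => ?_) (fun x y hx hy => ?_)
  · rw [smul_smul]
    exact Submodule.smul_mem_smul
      ((groupSubalgebra k L).mul_mem (of_mem_groupSubalgebra hl) hr) hw
  · rw [smul_add]; exact add_mem hx hy

theorem of_smul_mem_ideal_smul {l : N} (hl : l ∈ L) {u : W}
    (hu : u ∈ I.carrier • cyclicSub (k := k) L a) :
    MonoidAlgebra.of k N l • u ∈ I.carrier • cyclicSub (k := k) L a := by
  refine Submodule.smul_induction_on hu (fun r hr w hw => ?_) (fun x y hx hy => ?_)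
  · have e : MonoidAlgebra.of k N l • r • w =
        (MonoidAlgebra.of k N l * r * MonoidAlgebra.of k N l⁻¹) •
          (MonoidAlgebra.of k N l • w) := by
      rw [smul_smul, smul_smul, mul_assoc (MonoidAlgebra.of k N l * r), ← map_mul,
        inv_mul_cancel, map_one, mul_one]
    rw [e]
    exact Submodule.smul_mem_smul (I.conj_mem l r hr) (of_smul_mem_cyclicSub L a hl hw)
  · rw [smul_add]; exact add_mem hx hy

/-- The action of `L` on `U`, the `kL`-submodule generated by `a`. -/
noncomputable def cyclicRep : Representation k L ↥(cyclicSub (k := k) L a) where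
  toFun l := (Representation.ofModule' (k := k) (G := N) W l).restrict
    (fun u hu => by
      have := of_smul_mem_cyclicSub (k := k) L a l.2 hu
      simpa [Representation.ofModule'] using this)
  map_one' := by ext; simp
  map_mul' x y := by ext; simp

theorem cyclicRep_apply (l : L) (u : ↥(cyclicSub (k := k) L a)) :
    (cyclicRep L a l u : W) = MonoidAlgebra.of k N (l : N) • (u : W) := by
  simp [cyclicRep, Representation.ofModule']

theorem cyclicRep_mem (l : L) :
    idealSub I L a ≤ (idealSub I L a).comap (cyclicRep L a l) := by
  intro u hu
  have h := of_smul_mem_ideal_smul I L a l.2 (u := (u : W)) hu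
  show (cyclicRep L a l u : W) ∈ I.carrier • cyclicSub (k := k) L a
  rw [cyclicRep_apply]; exact h

/-- The action of `L` on the quotient `U / I U`. -/
noncomputable def quotientRep : Representation k L (CyclicQuotient I L a) where
  toFun l := (idealSub I L a).mapQ (idealSub I L a) (cyclicRep L a l) (cyclicRep_mem I L a l)
  map_one' := by
    ext u; simp
  map_mul' x y := by
    ext u; simp

/-- The image `L / I†` of `L` in `N / I†` (in use: `I† ≤ K ≤ L`). -/
def imageSubgroup : Subgroup (N ⧸ I.dagger) := L.map (QuotientGroup.mk' I.dagger)

/-- The projection of `L` onto `L / I†`. -/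
def imageProj : L →* imageSubgroup I L := (QuotientGroup.mk' I.dagger).subgroupMap L

theorem imageProj_surjective : Function.Surjective (imageProj I L) :=
  (QuotientGroup.mk' I.dagger).subgroupMap_surjective L

theorem imageProj_ker_le : (imageProj I L).ker ≤ (quotientRep I L a).ker := by
  intro l hl
  have h1 : (QuotientGroup.mk' I.dagger) (l : N) = 1 := congrArg Subtype.val hl
  have h2 : (l : N) ∈ I.dagger := (QuotientGroup.eq_one_iff _).1 h1
  have h3 : MonoidAlgebra.of k N (l : N) - 1 ∈ I.carrier := h2
  rw [MonoidHom.mem_ker]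
  ext u
  have h4 : cyclicRep L a l u - u ∈ idealSub I L a := by
    show ((cyclicRep L a l u - u : ↥(cyclicSub (k := k) L a)) : W) ∈
      I.carrier • cyclicSub (k := k) L a
    have e : ((cyclicRep L a l u - u : ↥(cyclicSub (k := k) L a)) : W) =
        (MonoidAlgebra.of k N (l : N) - 1) • (u : W) := by
      rw [sub_smul, one_smul, Submodule.coe_sub, cyclicRep_apply]
    rw [e]
    exact Submodule.smul_mem_smul h3 u.2
  simpa [quotientRep] using (Submodule.Quotient.eq _).2 h4

/-- The action of `L / I†` on `U / I U` induced by the action of `L`. -/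
noncomputable def imageRep : Representation k (imageSubgroup I L) (CyclicQuotient I L a) :=
  (QuotientGroup.lift (imageProj I L).ker (quotientRep I L a) (imageProj_ker_le I L a)).comp
    (QuotientGroup.quotientKerEquivOfSurjective (imageProj I L)
      (imageProj_surjective I L)).symm.toMonoidHom

/-- The class of `l ∈ L` acts on the class of `u ∈ U` as `l` acts on `u`. -/
theorem imageRep_apply (l : L) (u : ↥(cyclicSub (k := k) L a)) :
    imageRep I L a (imageProj I L l) ((idealSub I L a).mkQ u) =
      (idealSub I L a).mkQ (cyclicRep L a l u) := by
  have e : (QuotientGroup.quotientKerEquivOfSurjective (imageProj I L)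
      (imageProj_surjective I L)).symm (imageProj I L l) = (l : ↥L ⧸ (imageProj I L).ker) := by
    rw [MulEquiv.symm_apply_eq]; rfl
  show (QuotientGroup.lift (imageProj I L).ker (quotientRep I L a) (imageProj_ker_le I L a))
    ((QuotientGroup.quotientKerEquivOfSurjective (imageProj I L)
      (imageProj_surjective I L)).symm (imageProj I L l)) ((idealSub I L a).mkQ u) = _
  rw [e]; rfl

/-- `A ∩ L / I†` as a subgroup of `A`, for a (central) subgroup `A` of `N / I†`. -/
def centralPart (A : Subgroup (N ⧸ I.dagger)) : Subgroup A :=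
  (imageSubgroup I L).comap A.subtype

/-- The inclusion of `A ∩ L / I†` in `L / I†`. -/
def centralPartInclusion (A : Subgroup (N ⧸ I.dagger)) :
    centralPart I L A →* imageSubgroup I L :=
  (A.subtype.comp (centralPart I L A).subtype).codRestrict (imageSubgroup I L) (fun x => x.2)

/-- The `k[A ∩ L / I†]`-module `U / I U`, where `U` is the `kL`-submodule generated by `a`. -/
noncomputable def centralRep (A : Subgroup (N ⧸ I.dagger)) :
    Representation k (centralPart I L A) (CyclicQuotient I L a) :=
  (imageRep I L a).comp (centralPartInclusion I L A)

/-- `[μ_{kC}(U / I U)]_{kA}`, where `U` is the `kL`-submodule generated by `a`, and `C` is a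
subgroup of `A ∩ L / I†`. -/
noncomputable def invariantClasses (A : Subgroup (N ⧸ I.dagger)) [IsMulCommutative A]
    (C : Subgroup (centralPart I L A)) : Set (Set (PrimeSpectrum (MonoidAlgebra k A))) :=
  classesOver ((centralPart I L A).subtype.comp C.subtype)
    (minimalSupport ((centralRep I L a A).comp C.subtype))

end Module

/-- The subgroups `L` over which the modules `U / I U` are formed: `L` is dense in `N`,
`K ≤ L` and `L / K` is finitely generated. -/
structure IsAdmissible (K : Subgroup N) [K.Normal] (L : Subgroup N) : Prop where
  dense : IsDenseSubgroup L
  le : K ≤ L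
  fg : Group.FG (↥L ⧸ K.subgroupOf L)

end GroupRing

/-! ### Group rings of finitely generated nilpotent groups are Noetherian -/

/-! The classes attached to `a` and `L` depend only on the radical of the annihilator of `kLa / I
kLa` in `kX`, where `X` is a small enough finitely generated dense subgroup of `A`. Over a stable
subgroup `C` the module is finitely generated, so its minimal support consists of the primes minimal
over the annihilator. Stability moves these primes down to `kX`, and lying over moves them back up
to `kA` without changing classes (`IsStableSubgroup.classesOver_eq`). It remains to find a cyclic
submodule on whose nonzero elements this radical is constant.

The key fact is an Artin–Rees property (`exists_pow_smul_mem_ideal_smul`): if `x ∈ kL` is central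
modulo `I†` and maps a finitely generated `kL`-module `U` into `I U`, then for each `b ∈ U` some
power of `x` maps `b` into `I kLb`. The ring `kL` need not be Noetherian, but only finitely many
group elements are involved, so one works over a finitely generated subgroup `G ≤ L`, whose group
ring is Noetherian by P. Hall's theorem. Since `K / I†` is finite and the characteristic is `0`,
Maschke's theorem makes `I` modulo `I†` generated by a central idempotent. The kernel of `kG → k[N /
I†]` is polycentral because `G` is nilpotent. Ideals of this shape satisfy Artin–Rees
(`exists_pow_smul_mem_smul_of_polycentral`).

Consequently the radical does not depend on the admissible `L` (`annihilatorRadical_eq`), and it can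
only grow when `a` is replaced by a multiple `r • a` (`annihilatorRadical_le_smul`). As `kX` is
Noetherian for the finitely generated group `X = A ∩ L₀ / I†`, there is `v ≠ 0` with maximal radical
(`exists_forall_annihilatorRadical_eq`). Every nonzero element of `kNv` then has the same radical as
`v`, and `V = kNv` is the required submodule. -/

theorem exists_forall_ge_eq_of_monotone₂ {α : Type*} [PartialOrder α] [WellFoundedGT α]
    (g : ℕ → ℕ → α) (hg : ∀ m m' n n', m ≤ m' → n ≤ n' → g m n ≤ g m' n') :
    ∃ m₀, ∀ m, m₀ ≤ m → ∀ n, g m n = g m₀ n := by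
  -- The diagonal becomes constant at `d`, which settles all columns with index at least `d` at
  -- once. The finitely many remaining columns are stabilised one by one.
  obtain ⟨d, hd⟩ := WellFoundedGT.monotone_chain_condition
    (⟨fun k => g k k, fun a b h => hg _ _ _ _ h h⟩ : ℕ →o α)
  have hd' : ∀ m, d ≤ m → g d d = g m m := hd
  have hs : ∀ n, ∃ e, ∀ m, e ≤ m → g e n = g m n := fun n =>
    WellFoundedGT.monotone_chain_condition
      (⟨fun k => g k n, fun a b h => hg _ _ _ _ h le_rfl⟩ : ℕ →o α)
  choose e he using hs
  have hconst : ∀ m n, d ≤ m → d ≤ n → g m n = g d d := by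
    intro m n hm hn
    refine le_antisymm ?_ (hg _ _ _ _ hm hn)
    rw [hd' (max m n) (hm.trans (le_max_left _ _))]
    exact hg _ _ _ _ (le_max_left _ _) (le_max_right _ _)
  -- The sum is merely a common upper bound for `d` and all `e n` with `n < d`.
  refine ⟨d + ∑ n ∈ Finset.range d, e n, fun m hm n => ?_⟩
  by_cases hn : d ≤ n
  · rw [hconst _ _ (by omega) hn, hconst _ _ (by omega) hn]
  · have h1 : e n ≤ ∑ n ∈ Finset.range d, e n :=
      Finset.single_le_sum (f := e) (fun _ _ => Nat.zero_le _) (Finset.mem_range.2 (by omega))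
    rw [← he n m (by omega), ← he n (d + ∑ n ∈ Finset.range d, e n) (by omega)]

/-! ### Hilbert's basis theorem for skew Laurent extensions -/

section SkewLaurent

variable {R : Type*} [Ring R]

/-- The additive group of polynomials of degree `< n` in `t` with coefficients in `B` on the
right. -/
def skewPolynomialsLT (B : Subring R) (t : R) (n : ℕ) : AddSubgroup R where
  carrier := {x | ∃ c : ℕ → R, (∀ i, c i ∈ B) ∧ x = ∑ i ∈ Finset.range n, t ^ i * c i}
  zero_mem' := ⟨fun _ => 0, fun _ => B.zero_mem, by simp⟩
  add_mem' := by
    rintro _ _ ⟨c, hc, rfl⟩ ⟨d, hd, rfl⟩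
    exact ⟨fun i => c i + d i, fun i => B.add_mem (hc i) (hd i), by
      simp [mul_add, Finset.sum_add_distrib]⟩
  neg_mem' := by
    rintro _ ⟨c, hc, rfl⟩
    exact ⟨fun i => -c i, fun i => B.neg_mem (hc i), by simp⟩

variable {B : Subring R} {t u : R}

theorem skewPolynomialsLT_mono : Monotone (skewPolynomialsLT B t) := by
  rintro m n hmn _ ⟨c, hc, rfl⟩
  refine ⟨fun i => if i < m then c i else 0, fun i => ?_, ?_⟩
  · dsimp only; split_ifs
    · exact hc i
    · exact B.zero_mem
  · rw [← Finset.sum_subset (Finset.range_mono hmn)]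
    · refine Finset.sum_congr rfl fun i hi => ?_
      simp only [if_pos (Finset.mem_range.1 hi)]
    · intro i _ hi
      simp only [if_neg (mt Finset.mem_range.2 hi), mul_zero]

theorem mul_mem_skewPolynomialsLT_succ {n : ℕ} {x : R} (hx : x ∈ skewPolynomialsLT B t n) :
    t * x ∈ skewPolynomialsLT B t (n + 1) := by
  obtain ⟨c, hc, rfl⟩ := hx
  refine ⟨fun i => if i = 0 then 0 else c (i - 1), fun i => ?_, ?_⟩
  · dsimp only; split_ifs
    · exact B.zero_mem
    · exact hc _
  · rw [Finset.sum_range_succ']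
    simp [Finset.mul_sum, pow_succ', mul_assoc]

theorem pow_mul_mem_skewPolynomialsLT {n : ℕ} {x : R} (hx : x ∈ skewPolynomialsLT B t n) (m : ℕ) :
    t ^ m * x ∈ skewPolynomialsLT B t (n + m) := by
  induction m with
  | zero => simpa using hx
  | succ m ih => rw [pow_succ', mul_assoc]; exact mul_mem_skewPolynomialsLT_succ ih

theorem pow_mul_mem_skewPolynomialsLT_self {b : R} (hb : b ∈ B) (n : ℕ) :
    t ^ n * b ∈ skewPolynomialsLT B t (n + 1) := by
  refine ⟨fun i => if i = n then b else 0, fun i => ?_, ?_⟩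
  · dsimp only; split_ifs
    · exact hb
    · exact B.zero_mem
  · simp

theorem pow_mul_mul_pow_mem (h : ∀ b ∈ B, t * b * u ∈ B) (n : ℕ) {b : R} (hb : b ∈ B) :
    t ^ n * b * u ^ n ∈ B := by
  induction n with
  | zero => simpa using hb
  | succ n ih =>
    have e : t ^ (n + 1) * b * u ^ (n + 1) = t * (t ^ n * b * u ^ n) * u := by
      rw [pow_succ', pow_succ]; simp only [mul_assoc]
    rw [e]; exact h _ ih

/-- Coefficients are moved past powers of `t` by `b t ^ i = t ^ i (u ^ i b t ^ i)`. -/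
theorem mul_mem_skewPolynomialsLT (htu : t * u = 1) (h : ∀ b ∈ B, u * b * t ∈ B) {n : ℕ} {b x : R}
    (hb : b ∈ B) (hx : x ∈ skewPolynomialsLT B t n) : b * x ∈ skewPolynomialsLT B t n := by
  obtain ⟨c, hc, rfl⟩ := hx
  refine ⟨fun i => u ^ i * b * t ^ i * c i,
    fun i => B.mul_mem (pow_mul_mul_pow_mem h i hb) (hc i), ?_⟩
  rw [Finset.mul_sum]
  refine Finset.sum_congr rfl fun i _ => ?_
  rw [← mul_assoc, ← mul_assoc, ← mul_assoc, ← mul_assoc, pow_mul_pow_eq_one _ htu, one_mul]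

/-- The left ideal of `B` formed by the leading coefficients of the elements of `D` which are
polynomials of degree at most `n` in `t`. -/
def leadingCoeffs (htu : t * u = 1) (hut : u * t = 1) (h₁ : ∀ b ∈ B, t * b * u ∈ B)
    (h₂ : ∀ b ∈ B, u * b * t ∈ B) (D : Ideal R) (n : ℕ) : Ideal B where
  carrier := {r | ∃ y ∈ skewPolynomialsLT B t n, t ^ n * (r : R) + y ∈ D}
  zero_mem' := ⟨0, zero_mem _, by simp⟩
  add_mem' := by
    rintro r s ⟨y, hy, hr⟩ ⟨z, hz, hs⟩
    refine ⟨y + z, add_mem hy hz, ?_⟩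
    have := D.add_mem hr hs
    rwa [show t ^ n * ((r + s : B) : R) + (y + z) = t ^ n * (r : R) + y + (t ^ n * (s : R) + z) by
      push_cast; noncomm_ring]
  smul_mem' := by
    rintro b r ⟨y, hy, hr⟩
    -- Coefficients stand on the right, so the leading coefficient is multiplied on the left by `b`
    -- if the polynomial is multiplied by `t ^ n b u ^ n`.
    have hb' : t ^ n * (b : R) * u ^ n ∈ B := pow_mul_mul_pow_mem h₁ n b.2
    refine ⟨t ^ n * (b : R) * u ^ n * y, mul_mem_skewPolynomialsLT htu h₂ hb' hy, ?_⟩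
    have := D.mul_mem_left (t ^ n * (b : R) * u ^ n) hr
    rwa [mul_add, ← mul_assoc, mul_assoc _ (u ^ n), pow_mul_pow_eq_one _ hut, mul_one,
      mul_assoc (t ^ n)] at this

theorem leadingCoeffs_mono (htu : t * u = 1) (hut : u * t = 1) (h₁ : ∀ b ∈ B, t * b * u ∈ B)
    (h₂ : ∀ b ∈ B, u * b * t ∈ B) {D E : Ideal R} (hDE : D ≤ E) {m n : ℕ} (hmn : m ≤ n) :
    leadingCoeffs htu hut h₁ h₂ D m ≤ leadingCoeffs htu hut h₁ h₂ E n := by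
  have : leadingCoeffs htu hut h₁ h₂ D m ≤ leadingCoeffs htu hut h₁ h₂ D n := by
    refine monotone_nat_of_le_succ (f := leadingCoeffs htu hut h₁ h₂ D) (fun n => ?_) hmn
    rintro r ⟨y, hy, hr⟩
    refine ⟨t * y, mul_mem_skewPolynomialsLT_succ hy, ?_⟩
    have := D.mul_mem_left t hr
    rwa [mul_add, ← mul_assoc, ← pow_succ'] at this
  refine this.trans ?_
  rintro r ⟨y, hy, hr⟩
  exact ⟨y, hy, hDE hr⟩

/-- An element of `E` is first multiplied by a power of the unit `t` to make it a polynomial. Its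
leading term is then cancelled by an element of `D`, and induction on the degree applies. -/
theorem eq_of_leadingCoeffs_eq (htu : t * u = 1) (hut : u * t = 1) (h₁ : ∀ b ∈ B, t * b * u ∈ B)
    (h₂ : ∀ b ∈ B, u * b * t ∈ B)
    (hgen : ∀ x : R, ∃ m n : ℕ, t ^ m * x ∈ skewPolynomialsLT B t n)
    {D E : Ideal R} (hDE : D ≤ E)
    (h : ∀ n, leadingCoeffs htu hut h₁ h₂ D n = leadingCoeffs htu hut h₁ h₂ E n) : D = E := by
  have key : ∀ n, ∀ y ∈ skewPolynomialsLT B t n, y ∈ E → y ∈ D := by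
    intro n
    induction n with
    | zero =>
      rintro _ ⟨c, _, rfl⟩ _
      simp
    | succ n ih =>
      rintro y ⟨c, hc, hy⟩ hyE
      rw [Finset.sum_range_succ] at hy
      have hlead : (⟨c n, hc n⟩ : B) ∈ leadingCoeffs htu hut h₁ h₂ E n :=
        ⟨_, ⟨c, hc, rfl⟩, by rw [add_comm]; exact hy ▸ hyE⟩
      rw [← h n] at hlead
      obtain ⟨z, hz, hzD⟩ := hlead
      have h3 : y - (t ^ n * c n + z) ∈ D := by
        refine ih _ ?_ (E.sub_mem hyE (hDE hzD))
        have e : y - (t ^ n * c n + z) = ∑ i ∈ Finset.range n, t ^ i * c i - z := by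
          rw [hy]; abel
        rw [e]
        exact sub_mem ⟨c, hc, rfl⟩ hz
      have := D.add_mem h3 hzD
      rwa [sub_add_cancel] at this
  refine le_antisymm hDE fun x hx => ?_
  obtain ⟨m, n, hmn⟩ := hgen x
  have h4 := D.mul_mem_left (u ^ m) (key n _ hmn (E.mul_mem_left _ hx))
  rwa [← mul_assoc, pow_mul_pow_eq_one _ hut, one_mul] at h4

/-- Hilbert's basis theorem for skew Laurent extensions: a ring generated by a left Noetherian
subring and by a unit normalising it is left Noetherian. -/
theorem isNoetherianRing_of_skewLaurent (htu : t * u = 1) (hut : u * t = 1)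
    (h₁ : ∀ b ∈ B, t * b * u ∈ B) (h₂ : ∀ b ∈ B, u * b * t ∈ B)
    (hgen : ∀ x : R, ∃ m n : ℕ, t ^ m * x ∈ skewPolynomialsLT B t n) [IsNoetherianRing B] :
    IsNoetherianRing R := by
  rw [isNoetherianRing_iff, ← monotone_stabilizes_iff_noetherian]
  intro f
  obtain ⟨m₀, hm₀⟩ := exists_forall_ge_eq_of_monotone₂
    (fun m n => leadingCoeffs htu hut h₁ h₂ (f m) n)
    (fun m m' n n' hm hn => leadingCoeffs_mono htu hut h₁ h₂ (f.mono hm) hn)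
  exact ⟨m₀, fun m hm => eq_of_leadingCoeffs_eq htu hut h₁ h₂ hgen (f.mono hm)
    fun n => (hm₀ m hm n).symm⟩

end SkewLaurent

/-! ### P. Hall's theorem, by adjoining one generator at a time along the lower central series -/

section GroupRing

variable {G : Type*} [Group G] (k : Type*) [Field k]

theorem isNoetherianRing_monoidAlgebra_of_sup_zpowers {P : Subgroup G} [P.Normal] {t : G}
    (h : P ⊔ Subgroup.zpowers t = ⊤) [IsNoetherianRing (MonoidAlgebra k P)] :
    IsNoetherianRing (MonoidAlgebra k G) := by
  set B : Subring (MonoidAlgebra k G) := (MonoidAlgebra.mapDomainRingHom k P.subtype).range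
  have hB : IsNoetherianRing B := isNoetherianRing_range _
  have hconj : ∀ g : G, ∀ b ∈ B,
      MonoidAlgebra.single g 1 * b * MonoidAlgebra.single g⁻¹ 1 ∈ B := by
    rintro g _ ⟨x, rfl⟩
    induction x using MonoidAlgebra.induction_linear with
    | zero => simp
    | add x y hx hy => rw [map_add, mul_add, add_mul]; exact B.add_mem hx hy
    | single p r =>
      refine ⟨MonoidAlgebra.single ⟨g * p * g⁻¹, Subgroup.Normal.conj_mem ‹_› _ p.2 g⟩ r, ?_⟩
      simp [MonoidAlgebra.single_mul_single]
  refine isNoetherianRing_of_skewLaurent (B := B) (t := MonoidAlgebra.single t 1)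
    (u := MonoidAlgebra.single t⁻¹ 1)
    (by simp [MonoidAlgebra.single_mul_single, MonoidAlgebra.one_def])
    (by simp [MonoidAlgebra.single_mul_single, MonoidAlgebra.one_def])
    (hconj t) (by simpa using hconj t⁻¹) fun x => ?_
  induction x using MonoidAlgebra.induction_linear with
  | zero => exact ⟨0, 0, by simp⟩
  | add x y hx hy =>
    obtain ⟨m, n, hx⟩ := hx
    obtain ⟨m', n', hy⟩ := hy
    refine ⟨m + m', (n + m') + (n' + m), ?_⟩
    rw [mul_add]
    refine add_mem ?_ ?_
    · rw [add_comm m, pow_add, mul_assoc]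
      exact skewPolynomialsLT_mono (by omega) (pow_mul_mem_skewPolynomialsLT hx m')
    · rw [pow_add, mul_assoc]
      exact skewPolynomialsLT_mono (by omega) (pow_mul_mem_skewPolynomialsLT hy m)
  | single g r =>
    have hg : g ∈ Subgroup.zpowers t ⊔ P := by rw [sup_comm, h]; trivial
    obtain ⟨_, ⟨z, rfl⟩, p, hp, rfl⟩ := Subgroup.mem_sup_of_normal_right.1 hg
    -- Multiplication by `t ^ |z|` makes the exponent `|z| + z` nonnegative; the `+ 1` is there
    -- because the degree bound is strict.
    refine ⟨z.natAbs, (z.natAbs + z).toNat + 1, ?_⟩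
    have e : MonoidAlgebra.single t (1 : k) ^ z.natAbs * MonoidAlgebra.single (t ^ z * p) r =
        MonoidAlgebra.single t (1 : k) ^ (z.natAbs + z).toNat * MonoidAlgebra.single p r := by
      rw [MonoidAlgebra.single_pow, MonoidAlgebra.single_pow, MonoidAlgebra.single_mul_single,
        MonoidAlgebra.single_mul_single, ← mul_assoc]
      congr 2
      · rw [← zpow_natCast, ← zpow_add, ← zpow_natCast, Int.toNat_of_nonneg (by omega)]
      · simp
    have e' : MonoidAlgebra.single (t ^ z * p) r =
      MonoidAlgebra.single ((fun x => t ^ x) z * p) r := rfl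
    rw [← e', e]
    have hpB : MonoidAlgebra.single p r ∈ B :=
      RingHom.mem_range.2 ⟨MonoidAlgebra.single ⟨p, hp⟩ r, by simp⟩
    exact pow_mul_mem_skewPolynomialsLT_self hpB _

theorem isNoetherianRing_monoidAlgebra_sup_zpowers {P : Subgroup G} [P.Normal] (t : G)
    [IsNoetherianRing (MonoidAlgebra k P)] :
    IsNoetherianRing (MonoidAlgebra k ↥(P ⊔ Subgroup.zpowers t)) := by
  have hle : P ≤ P ⊔ Subgroup.zpowers t := le_sup_left
  have ht : t ∈ P ⊔ Subgroup.zpowers t := le_sup_right (a := P) (Subgroup.mem_zpowers t)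
  have : IsNoetherianRing (MonoidAlgebra k (P.subgroupOf (P ⊔ Subgroup.zpowers t))) :=
    isNoetherianRing_of_ringEquiv _
      (MonoidAlgebra.mapDomainRingEquiv k (Subgroup.subgroupOfEquivOfLe hle).symm)
  refine isNoetherianRing_monoidAlgebra_of_sup_zpowers k
    (P := P.subgroupOf (P ⊔ Subgroup.zpowers t)) (t := ⟨t, ht⟩) ?_
  rw [eq_top_iff]
  rintro ⟨x, hx⟩ -
  rw [sup_comm] at hx
  obtain ⟨_, ⟨z, rfl⟩, p, hp, rfl⟩ := Subgroup.mem_sup_of_normal_right.1 hx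
  rw [show (⟨(fun z => t ^ z) z * p, _⟩ : ↥(P ⊔ Subgroup.zpowers t)) =
    ⟨t, ht⟩ ^ z * ⟨p, hle hp⟩ by ext; simp]
  exact mul_mem (le_sup_right (a := P.subgroupOf _) (zpow_mem (Subgroup.mem_zpowers _) z))
    (le_sup_left (b := Subgroup.zpowers _) (Subgroup.mem_subgroupOf.2 hp))

open Subgroup in
theorem normal_of_lowerCentralSeries_succ_le {i : ℕ} {P : Subgroup G}
    (h₁ : (⊤ : Subgroup G).lowerCentralSeries (i + 1) ≤ P)
    (h₂ : P ≤ (⊤ : Subgroup G).lowerCentralSeries i) : P.Normal := by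
  refine ⟨fun x hx g => ?_⟩
  have h : ⁅g, x⁆ ∈ (⊤ : Subgroup G).lowerCentralSeries (i + 1) := by
    rw [Subgroup.lowerCentralSeries_succ, ← inv_mem_iff, commutatorElement_inv]
    exact commutator_mem_commutator (h₂ hx) (mem_top g)
  have := mul_mem (h₁ h) hx
  rwa [commutatorElement_def, inv_mul_cancel_right] at this

open Subgroup in
/-- The factors of the lower central series of a finitely generated group are finitely
generated. -/
theorem exists_finset_lowerCentralSeries_le [Group.FG G] (i : ℕ) :
    ∃ T : Finset G, (T : Set G) ⊆ (⊤ : Subgroup G).lowerCentralSeries i ∧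
      (⊤ : Subgroup G).lowerCentralSeries i ≤
        closure (T : Set G) ⊔ (⊤ : Subgroup G).lowerCentralSeries (i + 1) := by
  classical
  obtain ⟨S, hS⟩ := (Group.FG.out : (⊤ : Subgroup G).FG)
  induction i with
  | zero => exact ⟨S, by simp, by simp [hS]⟩
  | succ i ih =>
    obtain ⟨T, hTi, hT⟩ := ih
    set γ := (⊤ : Subgroup G).lowerCentralSeries
    have hT' : ((Finset.image₂ (fun x y => ⁅x, y⁆) T S : Finset G) : Set G) ⊆ γ (i + 1) := by
      intro z hz
      obtain ⟨x, hx, y, hy, rfl⟩ := Finset.mem_image₂.1 (Finset.mem_coe.1 hz)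
      exact commutator_mem_commutator (hTi hx) (mem_top y)
    refine ⟨Finset.image₂ (fun x y => ⁅x, y⁆) T S, hT', ?_⟩
    -- The candidates are the commutators of generators of the `i`-th factor with generators of the
    -- group. `H` is normal since it lies between two consecutive terms of the series, so it
    -- suffices that the `i`-th term is central modulo `H`, which is checked on generators.
    set H := closure ((Finset.image₂ (fun x y => ⁅x, y⁆) T S : Finset G) : Set G) ⊔ γ (i + 2)
    have hH₂ : γ (i + 2) ≤ H := le_sup_right
    have hH : H.Normal := normal_of_lowerCentralSeries_succ_le hH₂
      (sup_le ((closure_le _).2 hT') (Subgroup.lowerCentralSeries_antitone _ (by omega)))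
    have hcomm : ∀ x y : G, ⁅x, y⁆ ∈ H → (x : G ⧸ H) * y = y * x := by
      intro x y hxy
      have : ((⁅x, y⁆ : G) : G ⧸ H) = 1 := (QuotientGroup.eq_one_iff _).2 hxy
      rw [commutatorElement_def, QuotientGroup.mk_mul, QuotientGroup.mk_mul, QuotientGroup.mk_mul,
        QuotientGroup.mk_inv, QuotientGroup.mk_inv, mul_inv_eq_one, mul_inv_eq_iff_eq_mul] at this
      exact this
    have hcen : γ i ≤ (center (G ⧸ H)).comap (QuotientGroup.mk' H) := by
      refine hT.trans (sup_le ((closure_le _).2 fun x hx => ?_) fun x hx => ?_)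
      · have h1 : closure (S : Set G) ≤
            (centralizer {(x : G ⧸ H)}).comap (QuotientGroup.mk' H) := by
          refine (closure_le _).2 fun y hy => ?_
          refine mem_centralizer_singleton_iff.2 ?_
          refine (hcomm x y (le_sup_left (b := γ (i + 2)) (subset_closure ?_))).symm
          exact Finset.mem_coe.2 (Finset.mem_image₂_of_mem hx hy)
        rw [hS] at h1
        refine mem_center_iff.2 fun y => ?_
        obtain ⟨y, rfl⟩ := QuotientGroup.mk_surjective y
        exact mem_centralizer_singleton_iff.1 (h1 (mem_top y))
      · refine mem_center_iff.2 fun y => ?_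
        obtain ⟨y, rfl⟩ := QuotientGroup.mk_surjective y
        exact (hcomm x y (hH₂ (commutator_mem_commutator hx (mem_top y)))).symm
    show ⁅γ i, (⊤ : Subgroup G)⁆ ≤ H
    rw [commutator_le]
    intro x hx y _
    have h2 := mem_center_iff.1 (hcen hx) (y : G ⧸ H)
    rw [← QuotientGroup.eq_one_iff, commutatorElement_def, QuotientGroup.mk_mul,
      QuotientGroup.mk_mul, QuotientGroup.mk_mul, QuotientGroup.mk_inv, QuotientGroup.mk_inv,
      mul_inv_eq_one, mul_inv_eq_iff_eq_mul]
    exact h2.symm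

open Subgroup in
/-- P. Hall: the group ring of a finitely generated nilpotent group is Noetherian. -/
theorem isNoetherianRing_monoidAlgebra_of_fg_of_isNilpotent [Group.FG G] [Group.IsNilpotent G] :
    IsNoetherianRing (MonoidAlgebra k G) := by
  classical
  set γ := (⊤ : Subgroup G).lowerCentralSeries with hγ
  have step : ∀ i, IsNoetherianRing (MonoidAlgebra k (γ (i + 1))) →
      IsNoetherianRing (MonoidAlgebra k (γ i)) := by
    intro i hi
    obtain ⟨T, hTi, hT⟩ := exists_finset_lowerCentralSeries_le (G := G) i
    have hle : γ (i + 1) ≤ γ i := Subgroup.lowerCentralSeries_antitone _ (by omega)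
    have key : ∀ U : Finset G, (U : Set G) ⊆ γ i →
        IsNoetherianRing (MonoidAlgebra k ↥(closure (U : Set G) ⊔ γ (i + 1))) := by
      intro U
      induction U using Finset.induction_on with
      | empty => intro _; rw [Finset.coe_empty, Subgroup.closure_empty, bot_sup_eq]; exact hi
      | insert t U _ ih =>
        intro hU
        rw [Finset.coe_insert, Set.insert_subset_iff] at hU
        have := ih hU.2
        have hn : (closure (U : Set G) ⊔ γ (i + 1)).Normal :=
          normal_of_lowerCentralSeries_succ_le le_sup_right
            (sup_le ((closure_le _).2 hU.2) hle)
        rw [Finset.coe_insert, Set.insert_eq, Subgroup.closure_union, sup_assoc, sup_comm,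
          ← zpowers_eq_closure]
        exact isNoetherianRing_monoidAlgebra_sup_zpowers k t
    rw [show γ i = _ from le_antisymm hT (sup_le ((closure_le _).2 hTi) hle)]
    exact key T hTi
  obtain ⟨n, hn⟩ := Subgroup.nilpotent_iff_lowerCentralSeries.1 ‹Group.IsNilpotent G›
  -- Ascent from the trivial term, index `n`, to the whole group, index `0`.
  have all : ∀ j, j ≤ n → IsNoetherianRing (MonoidAlgebra k (γ (n - j))) := by
    intro j
    induction j with
    | zero =>
      intro _
      rw [Nat.sub_zero, hγ, hn]
      have : IsNoetherianRing (MonoidAlgebra k (Unit)) :=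
        isNoetherianRing_of_surjective k _ (algebraMap k _) fun x => by
          refine ⟨x.coeff (), ?_⟩
          ext
          simp [MonoidAlgebra.coe_algebraMap]
      exact isNoetherianRing_of_ringEquiv (MonoidAlgebra k Unit)
        (MonoidAlgebra.mapDomainRingEquiv k (MulEquiv.ofUnique (M := Unit) (N := (⊥ : Subgroup G))))
    | succ j ih =>
      intro hj
      have := ih (by omega)
      rw [show n - j = n - (j + 1) + 1 by omega] at this
      exact step _ this
  have h0 := all n le_rfl
  rw [Nat.sub_self, hγ, Subgroup.lowerCentralSeries_zero] at h0
  exact isNoetherianRing_of_ringEquiv (MonoidAlgebra k (⊤ : Subgroup G))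
    (MonoidAlgebra.mapDomainRingEquiv k Subgroup.topEquiv)

end GroupRing

/-! ### An Artin–Rees argument for polycentral ideals -/

section ArtinRees

universe u v

variable {R : Type u} [Ring R]

/-- Multiplication by an element `c` of `R` that acts centrally on `M`. -/
def centralEnd {M : Type v} [AddCommGroup M] [Module R M] (c : R)
    (h : ∀ (r : R) (u : M), c • r • u = r • c • u) : Module.End R M where
  toFun u := c • u
  map_add' := smul_add c
  map_smul' := h

/-- Artin–Rees for a single central element. A submodule `D` maximal subject to `f N ≤ D` and `D ⊓ N
≤ f N` already contains `f ^ n M` for large `n`. -/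
theorem exists_range_pow_inf_le_map {M : Type v} [AddCommGroup M] [Module R M] [IsNoetherian R M]
    (c : R) (h : ∀ (r : R) (u : M), c • r • u = r • c • u) (N : Submodule R M) :
    ∃ n, LinearMap.range (centralEnd c h ^ n) ⊓ N ≤ N.map (centralEnd c h) := by
  set f := centralEnd c h with hf
  have hinv : ∀ (D : Submodule R M) (u : M), u ∈ D → f u ∈ D := fun D u hu => D.smul_mem c hu
  obtain ⟨D, ⟨hND, hDN⟩, hmax⟩ := wellFounded_gt.has_min
    {D : Submodule R M | N.map f ≤ D ∧ D ⊓ N ≤ N.map f} ⟨N.map f, le_rfl, inf_le_left⟩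
  obtain ⟨n, hn⟩ := monotone_stabilizes_iff_noetherian.2 ‹IsNoetherian R M›
    ⟨fun n => D.comap (f ^ n), monotone_nat_of_le_succ fun n u hu => by
      rw [Submodule.mem_comap] at hu ⊢
      rw [pow_succ']
      exact hinv D _ hu⟩
  have hn' : ∀ u, (f ^ (n + 1)) u ∈ D → (f ^ n) u ∈ D := fun u hu => by
    have : u ∈ D.comap (f ^ (n + 1)) := hu
    rwa [← show D.comap (f ^ n) = D.comap (f ^ (n + 1)) from hn (n + 1) (by omega)] at this
  -- If `d + f ^ n u` lies in `N`, applying `f` puts `f ^ (n + 1) u` into `D`, hence `f ^ n u ∈ D`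
  -- by the choice of `n`. So the sum satisfies the conditions imposed on `D`, and maximality
  -- applies.
  have hE : D ⊔ LinearMap.range (f ^ n) ≤ D := by
    refine not_lt_iff_le_imp_ge.1 (hmax _ ⟨hND.trans le_sup_left, ?_⟩) le_sup_left
    rintro x ⟨hx, hxN⟩
    obtain ⟨d, hd, _, ⟨u, rfl⟩, rfl⟩ := Submodule.mem_sup.1 hx
    refine hDN ⟨D.add_mem hd (hn' u ?_), hxN⟩
    have h1 : f (d + (f ^ n) u) ∈ D := hND ⟨_, hxN, rfl⟩
    rw [map_add] at h1
    rw [pow_succ']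
    exact (D.add_mem_iff_right (hinv D d hd)).1 h1
  exact ⟨n, (inf_le_inf_right N (le_sup_right.trans hE)).trans hDN⟩

/-- The case of a module killed by `C`: there `e` commutes with the action of `s` and is the
identity on `J M`. Hence `s ^ m u = e s ^ m u = s ^ m e u`, and `e u ∈ J M'`. -/
theorem exists_pow_smul_mem_smul_of_isIdempotent {M : Type v} [AddCommGroup M] [Module R M]
    {J C : Ideal R} {e s : R} (he : e ∈ J) (hJe : ∀ r ∈ J, r - e * r ∈ C)
    (hcomm : ∀ r, e * r - r * e ∈ C) (hM : ∀ c ∈ C, ∀ u : M, c • u = 0) {m : ℕ}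
    (hm : ∀ u : M, s ^ m • u ∈ J • (⊤ : Submodule R M)) (M' : Submodule R M) :
    ∀ u ∈ M', s ^ m • u ∈ J • M' := by
  intro u hu
  have h1 : ∀ v ∈ J • (⊤ : Submodule R M), e • v = v := by
    intro v hv
    refine Submodule.smul_induction_on hv (fun r hr w _ => ?_) fun x y hx hy => ?_
    · have := hM _ (hJe r hr) w
      rw [sub_smul, sub_eq_zero, mul_smul] at this
      exact this.symm
    · rw [smul_add, hx, hy]
  have h2 := hM _ (hcomm (s ^ m)) u
  rw [sub_smul, sub_eq_zero, mul_smul, mul_smul, h1 _ (hm u)] at h2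
  rw [h2]
  exact Submodule.smul_mem _ _ (Submodule.smul_mem_smul he hu)

/-- Let `J` be an ideal of a Noetherian ring which is obtained from an ideal `C₀` with a
centralising system of generators by adding an element which is a central idempotent modulo `C₀`.
If some power of `s` maps a Noetherian module `M` into `J M`, then this holds for the submodules
of `M`, too. -/
theorem exists_pow_smul_mem_smul_of_polycentral [IsNoetherianRing R]
    {J C₀ : Ideal R} (hCJ : C₀ ≤ J) {e : R} (s : R) (he : e ∈ J)
    (hJe : ∀ r ∈ J, r - e * r ∈ C₀) (hcomm : ∀ r, e * r - r * e ∈ C₀)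
    (hchain : ∀ C : Ideal R, C.IsTwoSided → C < C₀ → ∃ c ∈ C₀, c ∉ C ∧ ∀ r, c * r - r * c ∈ C)
    (M : Type v) [AddCommGroup M] [Module R M] [IsNoetherian R M] (M' : Submodule R M)
    (hM : ∃ m : ℕ, ∀ u : M, s ^ m • u ∈ J • (⊤ : Submodule R M)) :
    ∃ m : ℕ, ∀ u ∈ M', s ^ m • u ∈ J • M' := by
  -- Noetherian induction on an ideal `C` that kills the module, descending from `C₀`; the assertion
  -- is the case `C = 0`.
  suffices H : ∀ C : Ideal R, C.IsTwoSided → C ≤ C₀ →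
      ∀ (M : Type v) [AddCommGroup M] [Module R M] [IsNoetherian R M] (M' : Submodule R M),
      (∀ c ∈ C, ∀ u : M, c • u = 0) →
      (∃ m : ℕ, ∀ u : M, s ^ m • u ∈ J • (⊤ : Submodule R M)) →
      ∃ m : ℕ, ∀ u ∈ M', s ^ m • u ∈ J • M' from
    H ⊥ inferInstance bot_le M M' (fun c hc u => by rw [(Submodule.mem_bot R).1 hc, zero_smul]) hM
  clear hM M'
  intro C
  induction C using WellFoundedGT.induction with
  | ind C ih =>
  intro hC hCC₀ M _ _ _ M' hCM hM
  rcases hCC₀.eq_or_lt with rfl | hlt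
  · obtain ⟨m, hm⟩ := hM
    exact ⟨m, exists_pow_smul_mem_smul_of_isIdempotent he hJe hcomm hCM hm M'⟩
  obtain ⟨c, hcC₀, hcC, hcr⟩ := hchain C hC hlt
  have hcent : ∀ (r : R) (u : M), c • r • u = r • c • u := fun r u => by
    have := hCM _ (hcr r) u
    rwa [sub_smul, sub_eq_zero, mul_smul, mul_smul] at this
  set f := centralEnd c hcent with hf
  have hC' : (C ⊔ Ideal.span {c}).IsTwoSided := ⟨fun {a} b ha => by
    obtain ⟨x, hx, y, hy, rfl⟩ := Submodule.mem_sup.1 ha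
    obtain ⟨r, rfl⟩ := Ideal.mem_span_singleton'.1 hy
    have e : (x + r * c) * b = x * b + r * (c * b - b * c) + r * b * c := by noncomm_ring
    rw [e]
    exact add_mem (add_mem (Ideal.mem_sup_left (hC.mul_mem_of_left _ hx))
      (Ideal.mem_sup_left (C.mul_mem_left _ (hcr b))))
      (Ideal.mem_sup_right (Ideal.mul_mem_left _ _ (Ideal.mem_span_singleton_self c)))⟩
  have hCC' : C < C ⊔ Ideal.span {c} := lt_of_le_of_ne le_sup_left fun h =>
    hcC (h ▸ Ideal.mem_sup_right (Ideal.mem_span_singleton_self c))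
  have hC'C₀ : C ⊔ Ideal.span {c} ≤ C₀ :=
    sup_le hCC₀ ((Ideal.span_singleton_le_iff_mem _).2 hcC₀)
  -- The quotient `M ⧸ K` below is a copy of `f ^ i M / f ^ (i + 1) M`. It is killed by `C` and by
  -- `c`, so the induction hypothesis for `C ⊔ (c)` applies to it.
  have layer : ∀ i : ℕ, ∃ m : ℕ, ∀ u : M, (f ^ i) u ∈ M' →
      s ^ m • (f ^ i) u ∈ J • M' ⊔ LinearMap.range (f ^ (i + 1)) := by
    intro i
    set K := (LinearMap.range (f ^ (i + 1))).comap (f ^ i) with hK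
    obtain ⟨m₀, hm₀⟩ := hM
    obtain ⟨m, hm⟩ := ih _ hCC' hC' hC'C₀ (M ⧸ K) ((M'.comap (f ^ i)).map K.mkQ)
      (by
        intro x hx u
        obtain ⟨u, rfl⟩ := K.mkQ_surjective u
        obtain ⟨y, hy, z, hz, rfl⟩ := Submodule.mem_sup.1 hx
        obtain ⟨r, rfl⟩ := Ideal.mem_span_singleton'.1 hz
        rw [← map_smul, Submodule.mkQ_apply, Submodule.Quotient.mk_eq_zero, add_smul,
          hCM y hy, zero_add, mul_smul]
        refine K.smul_mem r ⟨u, ?_⟩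
        rw [pow_succ]
        rfl)
      ⟨m₀, fun u => by
        obtain ⟨u, rfl⟩ := K.mkQ_surjective u
        have h1 : K.mkQ (s ^ m₀ • u) ∈ (J • (⊤ : Submodule R M)).map K.mkQ := ⟨_, hm₀ u, rfl⟩
        rw [Submodule.map_smul''] at h1
        rw [← map_smul]
        exact Submodule.smul_mono le_rfl le_top h1⟩
    refine ⟨m, fun u hu => ?_⟩
    have h1 := hm (K.mkQ u) ⟨u, hu, rfl⟩
    rw [← Submodule.map_smul''] at h1
    obtain ⟨w, hw, hwu⟩ := h1
    rw [← map_smul, ← sub_eq_zero, ← map_sub, Submodule.mkQ_apply,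
      Submodule.Quotient.mk_eq_zero] at hwu
    have h2 : (f ^ i) w ∈ J • M' := by
      have : (f ^ i) w ∈ (J • M'.comap (f ^ i)).map (f ^ i) := ⟨w, hw, rfl⟩
      rw [Submodule.map_smul''] at this
      exact Submodule.smul_mono le_rfl (Submodule.map_comap_le _ _) this
    have h3 : (f ^ i) (w - s ^ m • u) ∈ LinearMap.range (f ^ (i + 1)) := hwu
    rw [map_sub, map_smul] at h3
    have h4 := sub_mem (Submodule.mem_sup_left h2 :
      _ ∈ J • M' ⊔ LinearMap.range (f ^ (i + 1))) (Submodule.mem_sup_right h3)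
    rwa [sub_sub_cancel] at h4
  -- The layers are concatenated: what is left over in `f ^ i M ∩ M'` is pushed one layer further by
  -- another power of `s`.
  have filt : ∀ i : ℕ, ∃ m : ℕ, ∀ u ∈ M',
      s ^ m • u ∈ J • M' ⊔ LinearMap.range (f ^ i) ⊓ M' := by
    intro i
    induction i with
    | zero => exact ⟨0, fun u hu => Submodule.mem_sup_right ⟨⟨s ^ 0 • u, by simp⟩, by simpa using hu⟩⟩
    | succ i ihi =>
      obtain ⟨m, hm⟩ := ihi
      obtain ⟨m', hm'⟩ := layer i
      refine ⟨m' + m, fun u hu => ?_⟩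
      obtain ⟨j, hj, v, ⟨⟨w, rfl⟩, hv⟩, hjv⟩ := Submodule.mem_sup.1 (hm u hu)
      rw [pow_add s, mul_smul, ← hjv, smul_add]
      refine add_mem (Submodule.mem_sup_left (Submodule.smul_mem _ _ hj)) ?_
      obtain ⟨j', hj', v', hv', hjv'⟩ := Submodule.mem_sup.1 (hm' w hv)
      rw [← hjv']
      refine add_mem (Submodule.mem_sup_left hj') (Submodule.mem_sup_right ⟨hv', ?_⟩)
      rw [← eq_sub_iff_add_eq'] at hjv'
      rw [hjv']
      exact sub_mem (M'.smul_mem _ hv) (Submodule.smul_le_right hj')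
  -- The leftover in `f ^ n M ∩ M'` lies in `c M'`, and `c ∈ C₀ ≤ J`, so the filtration can be
  -- stopped at `n`.
  obtain ⟨n, hn⟩ := exists_range_pow_inf_le_map c hcent M'
  obtain ⟨m, hm⟩ := filt n
  refine ⟨m, fun u hu => (sup_le le_rfl (hn.trans ?_) : _ ≤ J • M') (hm u hu)⟩
  rintro _ ⟨w, hw, rfl⟩
  exact Submodule.smul_mem_smul (hCJ hcC₀) hw

/-- The ambient form of `exists_pow_smul_mem_smul_of_polycentral`. -/
theorem exists_pow_smul_mem_smul_span_of_polycentral {R : Type*} [Ring R] [IsNoetherianRing R]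
    {J C₀ : Ideal R} (hCJ : C₀ ≤ J) {e : R} (s : R) (he : e ∈ J)
    (hJe : ∀ r ∈ J, r - e * r ∈ C₀) (hcomm : ∀ r, e * r - r * e ∈ C₀)
    (hchain : ∀ C : Ideal R, C.IsTwoSided → C < C₀ → ∃ c ∈ C₀, c ∉ C ∧ ∀ r, c * r - r * c ∈ C)
    {M : Type*} [AddCommGroup M] [Module R M] {S : Set M} (hS : S.Finite)
    (hs : ∀ u ∈ Submodule.span R S, s • u ∈ J • Submodule.span R S) {b : M}
    (hb : b ∈ Submodule.span R S) : ∃ m : ℕ, s ^ m • b ∈ J • Submodule.span R {b} := by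
  set U := Submodule.span R S
  have : IsNoetherian R U := isNoetherian_span_of_finite _ hS
  have hmapJ : ∀ V : Submodule R U, (J • V).map U.subtype = J • V.map U.subtype :=
    fun V => Submodule.map_smul'' _ _ _
  obtain ⟨m, hm⟩ := exists_pow_smul_mem_smul_of_polycentral hCJ s he hJe hcomm hchain U
    (Submodule.span R {(⟨b, hb⟩ : U)})
    ⟨1, fun u => by
      have h5 : s • (u : M) ∈ (J • (⊤ : Submodule R U)).map U.subtype := by
        rw [hmapJ, Submodule.map_top, Submodule.range_subtype]
        exact hs u u.2
      obtain ⟨v, hv, hvu⟩ := h5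
      rw [pow_one, ← show v = s • u from Subtype.ext hvu]
      exact hv⟩
  have h7 : U.subtype (s ^ m • ⟨b, hb⟩) ∈ (J • Submodule.span R {(⟨b, hb⟩ : U)}).map U.subtype :=
    ⟨_, hm _ (Submodule.mem_span_singleton_self _), rfl⟩
  rw [hmapJ, Submodule.map_span, Set.image_singleton] at h7
  exact ⟨m, h7⟩

end ArtinRees

/-! ### Ideals of semisimple rings, and the kernel of the reduction modulo a normal subgroup -/

/-- Decompose `1 = e + c` along a complementary left ideal; `x c` lies in both summands, so it
vanishes for `x ∈ J`. -/
theorem Ideal.exists_right_identity_of_isSemisimpleRing {S : Type*} [Ring S] [IsSemisimpleRing S]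
    (J : Ideal S) (hJ : J.IsTwoSided) : ∃ e ∈ J, ∀ x ∈ J, x * e = x := by
  obtain ⟨C, hC⟩ := exists_isCompl J
  obtain ⟨e, he, c, hc, hec⟩ := Submodule.mem_sup.1 (hC.sup_eq_top ▸ Submodule.mem_top :
    (1 : S) ∈ J ⊔ C)
  refine ⟨e, he, fun x hx => ?_⟩
  have h0 : x * c = 0 := Submodule.disjoint_def.1 hC.disjoint _ (hJ.mul_mem_of_left c hx)
    (C.mul_mem_left x hc)
  calc x * e = x * (e + c) := by rw [mul_add, h0, add_zero]
    _ = x := by rw [hec, mul_one]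

theorem Ideal.exists_identity_of_isSemisimpleRing {S : Type*} [Ring S] [IsSemisimpleRing S]
    (J : Ideal S) (hJ : J.IsTwoSided) : ∃ e ∈ J, ∀ x ∈ J, x * e = x ∧ e * x = x := by
  obtain ⟨e, he, hxe⟩ := J.exists_right_identity_of_isSemisimpleRing hJ
  -- The right annihilator of `J` inside `J` vanishes: its own right identity `f` is killed on the
  -- left by all of `J`, so `y = y f = 0`. It contains `x - e x`, which makes `e` a left identity as
  -- well.
  let Y : Ideal S :=
    { carrier := {y | y ∈ J ∧ ∀ x ∈ J, x * y = 0}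
      zero_mem' := ⟨J.zero_mem, fun x _ => mul_zero x⟩
      add_mem' := fun {a b} ha hb => ⟨J.add_mem ha.1 hb.1, fun x hx => by
        rw [mul_add, ha.2 x hx, hb.2 x hx, add_zero]⟩
      smul_mem' := fun r y hy => ⟨J.mul_mem_left r hy.1, fun x hx => by
        rw [smul_eq_mul, ← mul_assoc]
        exact hy.2 _ (hJ.mul_mem_of_left r hx)⟩ }
  have hY : Y.IsTwoSided := ⟨fun {a} b ha => ⟨hJ.mul_mem_of_left b ha.1, fun x hx => by
    rw [← mul_assoc, ha.2 x hx, zero_mul]⟩⟩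
  obtain ⟨f, hf, hyf⟩ := Y.exists_right_identity_of_isSemisimpleRing hY
  refine ⟨e, he, fun x hx => ⟨hxe x hx, ?_⟩⟩
  have hmem : x - e * x ∈ Y := ⟨J.sub_mem hx (J.mul_mem_left e hx), fun z hz => by
    rw [mul_sub, ← mul_assoc, hxe z hz, sub_self]⟩
  have h1 := hyf _ hmem
  rw [hf.2 _ hmem.1] at h1
  exact (sub_eq_zero.1 h1.symm).symm

/-! ### Reduction modulo a normal subgroup, and the central idempotent of an invariant ideal -/

section Reduction

variable {N : Type*} [Group N] {k : Type*} [Field k]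

theorem single_mem_groupSubalgebra {H : Subgroup N} {h : N} (hh : h ∈ H) (r : k) :
    MonoidAlgebra.single h r ∈ groupSubalgebra k H :=
  ⟨MonoidAlgebra.single ⟨h, hh⟩ r, by simp⟩

theorem groupSubalgebra_induction {H : Subgroup N} {p : MonoidAlgebra k N → Prop}
    (zero : p 0) (add : ∀ x y, p x → p y → p (x + y))
    (single : ∀ h ∈ H, ∀ r, p (MonoidAlgebra.single h r)) {x : MonoidAlgebra k N}
    (hx : x ∈ groupSubalgebra k H) : p x := by
  obtain ⟨y, rfl⟩ := hx
  induction y using MonoidAlgebra.induction_linear with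
  | zero => simpa using zero
  | add x y hx hy => rw [map_add]; exact add _ _ hx hy
  | single h r => simpa using single h h.2 r

theorem groupSubalgebra_mono {H G : Subgroup N} (h : H ≤ G) :
    groupSubalgebra k H ≤ groupSubalgebra k G := fun _ hx =>
  groupSubalgebra_induction (zero_mem _) (fun _ _ => add_mem)
    (fun _ hg r => single_mem_groupSubalgebra (h hg) r) hx

/-- The reduction homomorphism from `kN` to `k[N / H]`. -/
noncomputable def reduction (k : Type*) [Field k] (H : Subgroup N) [H.Normal] :
    MonoidAlgebra k N →+* MonoidAlgebra k (N ⧸ H) :=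
  MonoidAlgebra.mapDomainRingHom k (QuotientGroup.mk' H)

theorem reduction_single (H : Subgroup N) [H.Normal] (g : N) (r : k) :
    reduction k H (MonoidAlgebra.single g r) = MonoidAlgebra.single (g : N ⧸ H) r := by
  simp [reduction]

/-- The kernel of the reduction modulo `H` on `kG` is generated by the elements `h - 1` with
`h ∈ H ∩ G`. -/
theorem mem_span_of_reduction_eq_zero (H G : Subgroup N) [H.Normal] {x : MonoidAlgebra k N}
    (hx : x ∈ groupSubalgebra k G) (h0 : reduction k H x = 0) :
    x ∈ Submodule.span k {y : MonoidAlgebra k N | ∃ h ∈ H ⊓ G, ∃ g ∈ G,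
      y = (MonoidAlgebra.of k N h - 1) * MonoidAlgebra.of k N g} := by
  classical
  set T := {y : MonoidAlgebra k N | ∃ h ∈ H ⊓ G, ∃ g ∈ G,
      y = (MonoidAlgebra.of k N h - 1) * MonoidAlgebra.of k N g}
  -- A section of the quotient map with values in `G` over the image of `G`. The default value `1`
  -- is harmless, since only cosets of elements of `G` occur. Every `x ∈ kG` is congruent modulo the
  -- span to its image under reduction followed by `s`.
  let s : N ⧸ H → N := fun q => if h : ∃ g ∈ G, (g : N ⧸ H) = q then h.choose else 1
  have hs : ∀ g ∈ G, s g ∈ G ∧ ((s g : N) : N ⧸ H) = g := fun g hg => by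
    have h : ∃ g' ∈ G, (g' : N ⧸ H) = g := ⟨g, hg, rfl⟩
    simp only [s, dif_pos h]
    exact h.choose_spec
  have key : x - MonoidAlgebra.mapDomain s (reduction k H x) ∈ Submodule.span k T := by
    refine groupSubalgebra_induction (H := G)
      (p := fun x => x - MonoidAlgebra.mapDomain s (reduction k H x) ∈ Submodule.span k T)
      (by simp) (fun x y hx hy => ?_) (fun g hg r => ?_) hx
    · rw [map_add, MonoidAlgebra.mapDomain_add, add_sub_add_comm]
      exact add_mem hx hy
    · rw [reduction_single, MonoidAlgebra.mapDomain_single]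
      have e : MonoidAlgebra.single g r - MonoidAlgebra.single (s g) r =
          r • ((MonoidAlgebra.of k N (g * (s g)⁻¹) - 1) * MonoidAlgebra.of k N (s g)) := by
        rw [sub_mul, ← map_mul, inv_mul_cancel_right, one_mul, smul_sub]
        simp [MonoidAlgebra.of_apply]
      rw [e]
      refine Submodule.smul_mem _ _ (Submodule.subset_span
        ⟨g * (s g)⁻¹, ⟨?_, G.mul_mem hg (G.inv_mem (hs g hg).1)⟩, s g, (hs g hg).1, rfl⟩)
      refine (QuotientGroup.eq_one_iff _).1 ?_
      rw [QuotientGroup.mk_mul, QuotientGroup.mk_inv, (hs g hg).2, mul_inv_cancel]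
  rwa [h0, MonoidAlgebra.mapDomain_zero, sub_zero] at key

namespace InvariantIdeal

variable {K : Subgroup N}

/-- If `K / I†` is finite, then in characteristic `0` the ideal `I` is generated modulo `I†` by a
central idempotent of `k[N / I†]`. -/
theorem exists_central_idempotent [CharZero k] (I : InvariantIdeal k K)
    (hfin : Finite (↥K ⧸ I.dagger.subgroupOf K)) :
    ∃ e ∈ I.carrier, (∀ r, reduction k I.dagger (e * r) = reduction k I.dagger (r * e)) ∧
      ∀ x ∈ I.carrier, reduction k I.dagger (e * x) = reduction k I.dagger x := by
  set π := reduction k I.dagger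
  set Q := K.map (QuotientGroup.mk' I.dagger)
  set ρ : K →* Q := (QuotientGroup.mk' I.dagger).subgroupMap K
  have hρ : Function.Surjective ρ := (QuotientGroup.mk' I.dagger).subgroupMap_surjective K
  have : Finite Q := by
    refine Finite.of_surjective (QuotientGroup.lift (I.dagger.subgroupOf K) ρ fun x hx => ?_)
      fun q => ?_
    · exact Subtype.ext ((QuotientGroup.eq_one_iff _).2 (Subgroup.mem_subgroupOf.1 hx))
    · obtain ⟨x, rfl⟩ := hρ q
      exact ⟨(x : ↥K ⧸ I.dagger.subgroupOf K), rfl⟩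
  set j := MonoidAlgebra.mapDomainRingHom k Q.subtype
  have hj : Function.Injective j := MonoidAlgebra.mapDomain_injective Q.subtype_injective
  have hcomp : ∀ y : MonoidAlgebra k K, j (MonoidAlgebra.mapDomainRingHom k ρ y) =
      π (MonoidAlgebra.mapDomainRingHom k K.subtype y) := by
    intro y
    simp only [j, π, reduction, ← RingHom.comp_apply, ← MonoidAlgebra.mapDomainRingHom_comp]
    rfl
  have hlift : ∀ r : MonoidAlgebra k Q, ∃ r' ∈ groupSubalgebra k K, π r' = j r := by
    intro r
    induction r using MonoidAlgebra.induction_linear with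
    | zero => exact ⟨0, zero_mem _, by simp⟩
    | add x y hx hy =>
      obtain ⟨x', hx', hx⟩ := hx
      obtain ⟨y', hy', hy⟩ := hy
      exact ⟨x' + y', add_mem hx' hy', by rw [map_add, map_add, hx, hy]⟩
    | single q r =>
      obtain ⟨g, rfl⟩ := hρ q
      refine ⟨_, single_mem_groupSubalgebra g.2 r, ?_⟩
      rw [reduction_single, MonoidAlgebra.mapDomainRingHom_apply, MonoidAlgebra.mapDomain_single]
      rfl
  -- The image of `I` in the group ring of the finite group `Q = K / I†`, which is semisimple by
  -- Maschke's theorem.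
  let J : Ideal (MonoidAlgebra k Q) :=
    { carrier := {y | ∃ x ∈ I.carrier, π x = j y}
      zero_mem' := ⟨0, zero_mem _, by simp⟩
      add_mem' := by
        rintro a b ⟨x, hx, hxa⟩ ⟨y, hy, hyb⟩
        exact ⟨x + y, add_mem hx hy, by rw [map_add, map_add, hxa, hyb]⟩
      smul_mem' := by
        rintro r a ⟨x, hx, hxa⟩
        obtain ⟨r', hr', hrr'⟩ := hlift r
        exact ⟨r' * x, I.mul_mem_left r' hr' x hx, by
          rw [smul_eq_mul, map_mul, map_mul, hxa, hrr']⟩ }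
  have hJ : J.IsTwoSided := ⟨by
    rintro a r ⟨x, hx, hxa⟩
    obtain ⟨r', hr', hrr'⟩ := hlift r
    exact ⟨x * r', I.mul_mem_right r' hr' x hx, by rw [map_mul, map_mul, hxa, hrr']⟩⟩
  obtain ⟨ε, ⟨e, he, heε⟩, hε⟩ := J.exists_identity_of_isSemisimpleRing hJ
  have hid : ∀ x ∈ I.carrier, π (x * e) = π x ∧ π (e * x) = π x := by
    intro x hx
    obtain ⟨x', hx'⟩ := I.le_groupRing hx
    have hx'' : j (MonoidAlgebra.mapDomainRingHom k ρ x') = π x := by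
      rw [hcomp]; exact congrArg π hx'
    obtain ⟨h1, h2⟩ := hε _ ⟨x, hx, hx''.symm⟩
    rw [map_mul, map_mul, heε, ← hx'', ← map_mul, ← map_mul, h1, h2]
    exact ⟨rfl, rfl⟩
  refine ⟨e, he, fun r => ?_, fun x hx => (hid x hx).2⟩
  induction r using MonoidAlgebra.induction_linear with
  | zero => simp
  | add x y hx hy => rw [mul_add, add_mul, map_add, map_add, hx, hy]
  | single g r =>
    set u := MonoidAlgebra.of k N g with hu
    set v := MonoidAlgebra.of k N g⁻¹ with hv
    have huv : u * v = 1 := by rw [hu, hv, ← map_mul, mul_inv_cancel, map_one]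
    have hvu : v * u = 1 := by rw [hu, hv, ← map_mul, inv_mul_cancel, map_one]
    have hconj : ∀ x ∈ I.carrier, v * x * u ∈ I.carrier := fun x hx => by
      have := I.conj_mem g⁻¹ x hx
      rwa [inv_inv] at this
    -- Since `I` is `N`-invariant, the conjugate `u e v` is another identity of the image of `I`.
    -- The product of the two identities equals each of them, so `e` commutes with `g` modulo `I†`.
    have h1 : π (u * e * v * e) = π (u * e * v) := (hid _ (I.conj_mem g e he)).1
    have h2 : π (u * e * v * e) = π e := by
      have h3 : u * e * v * e = u * (e * (v * e * u)) * v := by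
        calc u * e * v * e = u * e * v * e * (u * v) := by rw [huv, mul_one]
          _ = _ := by simp only [mul_assoc]
      rw [h3, map_mul, map_mul, (hid _ (hconj e he)).2, ← map_mul, ← map_mul]
      congr 1
      calc u * (v * e * u) * v = (u * v) * e * (u * v) := by simp only [mul_assoc]
        _ = e := by rw [huv, one_mul, mul_one]
    have h4 : π (e * u) = π (u * e) := by
      rw [map_mul, ← h2, h1, ← map_mul]
      congr 1
      rw [mul_assoc, hvu, mul_one]
    have h5 : (MonoidAlgebra.single g r : MonoidAlgebra k N) = r • u := by
      simp [hu, MonoidAlgebra.of_apply]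
    rw [h5, mul_smul_comm, smul_mul_assoc]
    have h6 : ∀ y : MonoidAlgebra k N, r • y = algebraMap k _ r * y := fun y =>
      Algebra.smul_def r y
    rw [h6, h6, map_mul π, h4, ← map_mul]

end InvariantIdeal

end Reduction

/-! ### Central elements modulo an invariant ideal -/

section LocalIdeal

variable {N : Type*} [Group N] {k : Type*} [Field k]

/-- The canonical surjection of the group ring of `G` onto its image in `kN`. -/
noncomputable def toGroupSubalgebra (k : Type*) [Field k] (G : Subgroup N) :
    MonoidAlgebra k G →ₐ[k] groupSubalgebra k G :=
  (MonoidAlgebra.mapDomainAlgHom k k G.subtype).rangeRestrict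

theorem toGroupSubalgebra_surjective (G : Subgroup N) :
    Function.Surjective (toGroupSubalgebra k G) :=
  AlgHom.rangeRestrict_surjective _

theorem toGroupSubalgebra_single (G : Subgroup N) (g : G) (r : k) :
    (toGroupSubalgebra k G (MonoidAlgebra.single g r) : MonoidAlgebra k N) =
      MonoidAlgebra.single (g : N) r :=
  MonoidAlgebra.mapDomain_single

theorem isNoetherianRing_groupSubalgebra [Group.IsNilpotent N] {G : Subgroup N} (hG : G.FG) :
    IsNoetherianRing (groupSubalgebra k G) := by
  have : Group.FG G := (Group.fg_iff_subgroup_fg G).2 hG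
  have := isNoetherianRing_monoidAlgebra_of_fg_of_isNilpotent (G := G) k
  exact isNoetherianRing_of_surjective _ _ (toGroupSubalgebra k G).toRingHom
    (toGroupSubalgebra_surjective G)

theorem exists_finset_forall_mem_groupSubalgebra {L : Subgroup N} {x : MonoidAlgebra k N}
    (hx : x ∈ groupSubalgebra k L) :
    ∃ T : Finset N, (T : Set N) ⊆ L ∧
      ∀ G : Subgroup N, (T : Set N) ⊆ G → x ∈ groupSubalgebra k G := by
  classical
  refine groupSubalgebra_induction (H := L)
    (p := fun x => ∃ T : Finset N, (T : Set N) ⊆ L ∧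
      ∀ G : Subgroup N, (T : Set N) ⊆ G → x ∈ groupSubalgebra k G)
    ?_ (fun x y hx hy => ?_) (fun h hh r => ?_) hx
  · exact ⟨∅, by simp, fun G _ => zero_mem _⟩
  · obtain ⟨T, hTL, hT⟩ := hx
    obtain ⟨T', hTL', hT'⟩ := hy
    refine ⟨T ∪ T', by simp [hTL, hTL'], fun G hG => ?_⟩
    rw [Finset.coe_union, Set.union_subset_iff] at hG
    exact add_mem (hT G hG.1) (hT' G hG.2)
  · exact ⟨{h}, by simpa using hh, fun G hG => single_mem_groupSubalgebra (by simpa using hG) r⟩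

/-- An element of `kN` whose image in `k[N / H]` is central. -/
def IsCentralModulo (H : Subgroup N) [H.Normal] (x : MonoidAlgebra k N) : Prop :=
  ∀ r, reduction k H (x * r) = reduction k H (r * x)

theorem IsCentralModulo.pow {H : Subgroup N} [H.Normal] {x : MonoidAlgebra k N}
    (hx : IsCentralModulo H x) (m : ℕ) : IsCentralModulo H (x ^ m) := by
  have hc : ∀ r, Commute (reduction k H x) (reduction k H r) := fun r => by
    have := hx r
    rwa [map_mul, map_mul] at this
  intro r
  rw [map_mul, map_mul, map_pow]
  exact (hc r).pow_left m

/-! ### The two ideals of `kG` that enter the Artin–Rees argument -/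

section Core

variable {H : Subgroup N} [H.Normal] {e : MonoidAlgebra k N}

/-- The ideal of `kG` formed by the elements fixed by `e` modulo `H`. -/
def fixedIdeal (he : IsCentralModulo H e) (G : Subgroup N) : Ideal (groupSubalgebra k G) where
  carrier := {r | reduction k H (e * r) = reduction k H r}
  zero_mem' := by simp
  add_mem' {r s} hr hs := by
    simp only [Set.mem_ofPred_eq] at hr hs ⊢
    rw [Subalgebra.coe_add, mul_add, map_add, map_add, hr, hs]
  smul_mem' r s hs := by
    simp only [Set.mem_ofPred_eq] at hs ⊢
    rw [smul_eq_mul, Subalgebra.coe_mul, ← mul_assoc, map_mul, he r, ← map_mul, mul_assoc, map_mul,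
      hs, map_mul]

theorem mem_fixedIdeal {he : IsCentralModulo H e} {G : Subgroup N} {r : groupSubalgebra k G} :
    r ∈ fixedIdeal he G ↔ reduction k H (e * r) = reduction k H r := Iff.rfl

/-- The kernel of the reduction modulo `H` on `kG`. -/
noncomputable def reductionKer (k : Type*) [Field k] (H : Subgroup N) [H.Normal] (G : Subgroup N) :
    Ideal (groupSubalgebra k G) :=
  RingHom.ker ((reduction k H).comp (groupSubalgebra k G).subtype)

theorem mem_reductionKer {G : Subgroup N} {r : groupSubalgebra k G} :
    r ∈ reductionKer k H G ↔ reduction k H r = 0 := Iff.rfl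

theorem reductionKer_le_of_forall_single_sub_one_mem {G : Subgroup N}
    {C : Ideal (groupSubalgebra k G)} (hC : C.IsTwoSided)
    (h : ∀ g : G, (g : N) ∈ H → toGroupSubalgebra k G (MonoidAlgebra.of k G g) - 1 ∈ C) :
    reductionKer k H G ≤ C := by
  intro r hr
  have h1 : (r : MonoidAlgebra k N) ∈
      (C.restrictScalars k).map (groupSubalgebra k G).val.toLinearMap := by
    refine (Submodule.span_le.2 ?_) (mem_span_of_reduction_eq_zero H G r.2 hr)
    rintro _ ⟨h', ⟨hh, hG⟩, g, hg, rfl⟩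
    refine ⟨(toGroupSubalgebra k G (MonoidAlgebra.of k G ⟨h', hG⟩) - 1) *
      toGroupSubalgebra k G (MonoidAlgebra.of k G ⟨g, hg⟩),
      hC.mul_mem_of_left _ (h ⟨h', hG⟩ hh), ?_⟩
    simp [MonoidAlgebra.of_apply, toGroupSubalgebra_single]
  obtain ⟨r', hr', h2⟩ := h1
  rwa [← Subtype.ext (h2 : (r' : MonoidAlgebra k N) = r)]

/-- Among the `h ∈ G ∩ H` with `h - 1 ∉ C`, take one lying lowest in the upper central series of
`G`. The commutators `[h, g]` lie lower, so `[h, g] - 1 ∈ C`, and `h g - g h = ([h, g] - 1) g h`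
shows that `h - 1` is central modulo `C`. -/
theorem exists_central_of_lt_reductionKer [Group.IsNilpotent N] {G : Subgroup N}
    {C : Ideal (groupSubalgebra k G)} (hC : C.IsTwoSided) (hlt : C < reductionKer k H G) :
    ∃ c ∈ reductionKer k H G, c ∉ C ∧ ∀ r, c * r - r * c ∈ C := by
  classical
  set φ := toGroupSubalgebra k G
  have hex : ∃ i : ℕ, ∃ h : G, h ∈ Subgroup.upperCentralSeries G i ∧ (h : N) ∈ H ∧
      φ (MonoidAlgebra.of k G h) - 1 ∉ C := by
    by_contra hcon
    push Not at hcon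
    obtain ⟨n, hn⟩ := (inferInstance : Group.IsNilpotent G).nilpotent'
    exact not_le_of_gt hlt (reductionKer_le_of_forall_single_sub_one_mem hC fun g hg =>
      hcon n g (hn ▸ Subgroup.mem_top g) hg)
  obtain ⟨h, hi, hH, hhC⟩ := Nat.find_spec hex
  have hmin : ∀ j < Nat.find hex, ∀ g : G, g ∈ Subgroup.upperCentralSeries G j → (g : N) ∈ H →
      φ (MonoidAlgebra.of k G g) - 1 ∈ C := fun j hj g h1 h2 => by
    by_contra h3
    exact Nat.find_min hex hj ⟨g, h1, h2, h3⟩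
  refine ⟨φ (MonoidAlgebra.of k G h) - 1, ?_, hhC, fun r => ?_⟩
  · rw [mem_reductionKer, Subalgebra.coe_sub, MonoidAlgebra.of_apply, toGroupSubalgebra_single,
      map_sub, reduction_single, (QuotientGroup.eq_one_iff _).2 hH, ← MonoidAlgebra.one_def,
      Subalgebra.coe_one, map_one, sub_self]
  · obtain ⟨j, hj⟩ : ∃ j, Nat.find hex = j + 1 := by
      refine Nat.exists_eq_succ_of_ne_zero fun h0 => hhC ?_
      rw [h0, Subgroup.upperCentralSeries_zero, Subgroup.mem_bot] at hi
      rw [hi, map_one, map_one, sub_self]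
      exact C.zero_mem
    rw [hj, Subgroup.mem_upperCentralSeries_succ_iff] at hi
    obtain ⟨y, rfl⟩ := toGroupSubalgebra_surjective G r
    rw [sub_mul, mul_sub, one_mul, mul_one, sub_sub_sub_cancel_right]
    induction y using MonoidAlgebra.induction_linear with
    | zero => simp
    | add x y hx hy =>
      rw [map_add, mul_add, add_mul, add_sub_add_comm]
      exact C.add_mem hx hy
    | single g r =>
      have h1 : φ (MonoidAlgebra.of k G ⁅h, g⁆) - 1 ∈ C := by
        refine hmin j (by omega) _ (hi g) ?_
        have := H.mul_mem hH (Subgroup.Normal.conj_mem ‹H.Normal› _ (H.inv_mem hH) (g : N))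
        simpa [commutatorElement_def, mul_assoc] using this
      have h2 := C.mul_mem_left (algebraMap k _ r)
        (hC.mul_mem_of_left (φ (MonoidAlgebra.of k G (g * h))) h1)
      have e1 : (MonoidAlgebra.single g r : MonoidAlgebra k G) = r • MonoidAlgebra.of k G g := by
        simp [MonoidAlgebra.of_apply]
      have e2 : ⁅h, g⁆ * (g * h) = h * g := by simp [commutatorElement_def, mul_assoc]
      rw [sub_mul, one_mul, ← map_mul, ← map_mul, e2, ← Algebra.smul_def, smul_sub] at h2
      rw [e1, map_smul, mul_smul_comm, smul_mul_assoc, ← map_mul, ← map_mul, ← map_mul, ← map_mul]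
      exact h2

end Core

/-! ### Descent to finitely generated subgroups and the Artin–Rees property of `I` -/

section Module

variable {W : Type*} [AddCommGroup W] [Module k W]
  [Module (MonoidAlgebra k N) W] [IsScalarTower k (MonoidAlgebra k N) W]

/-- The `kL`-submodule of `W` generated by `S`. -/
noncomputable def generatedSub (k : Type*) [Field k] [Module k W] [Module (MonoidAlgebra k N) W]
    [IsScalarTower k (MonoidAlgebra k N) W] (L : Subgroup N) (S : Set W) : Submodule k W :=
  (groupSubalgebra k L).toSubmodule • Submodule.span k S

variable {L : Subgroup N} {S : Set W}

theorem smul_mem_generatedSub {r : MonoidAlgebra k N} (hr : r ∈ groupSubalgebra k L) {u : W}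
    (hu : u ∈ generatedSub k L S) : r • u ∈ generatedSub k L S := by
  refine Submodule.smul_induction_on hu (fun x hx w hw => ?_) (fun x y hx hy => ?_)
  · rw [smul_smul]
    exact Submodule.smul_mem_smul ((groupSubalgebra k L).mul_mem hr hx) hw
  · rw [smul_add]; exact add_mem hx hy

theorem span_le_generatedSub : Submodule.span k S ≤ generatedSub k L S := fun w hw => by
  have := Submodule.smul_mem_smul (show (1 : MonoidAlgebra k N) ∈ (groupSubalgebra k L).toSubmodule
    from one_mem (groupSubalgebra k L)) hw
  rwa [one_smul] at this

theorem subset_generatedSub {s : W} (hs : s ∈ S) : s ∈ generatedSub k L S :=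
  span_le_generatedSub (Submodule.subset_span hs)

theorem generatedSub_le {L L' : Subgroup N} (hL : L ≤ L') {S T : Set W}
    (h : ∀ s ∈ S, s ∈ generatedSub k L' T) : generatedSub k L S ≤ generatedSub k L' T := by
  refine Submodule.smul_le.2 fun r hr w hw => smul_mem_generatedSub (groupSubalgebra_mono hL hr) ?_
  exact (Submodule.span_le.2 h) hw

variable {K : Subgroup N} {I : InvariantIdeal k K}

theorem smul_mem_ideal_smul {r : MonoidAlgebra k N} (hr : r ∈ groupSubalgebra k L) {u : W}
    (hu : u ∈ I.carrier • generatedSub k L S) : r • u ∈ I.carrier • generatedSub k L S := by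
  refine groupSubalgebra_induction (H := L)
    (p := fun r => r • u ∈ I.carrier • generatedSub k L S) (by simp)
    (fun x y hx hy => by rw [add_smul]; exact add_mem hx hy) (fun g hg c => ?_) hr
  have e : (MonoidAlgebra.single g c : MonoidAlgebra k N) = c • MonoidAlgebra.of k N g := by
    simp [MonoidAlgebra.of_apply]
  rw [e, smul_assoc]
  refine Submodule.smul_mem _ _ ?_
  refine Submodule.smul_induction_on hu (fun x hx w hw => ?_) (fun x y hx hy => ?_)
  · have e : MonoidAlgebra.of k N g • x • w = (MonoidAlgebra.of k N g * x *
        MonoidAlgebra.of k N g⁻¹) • (MonoidAlgebra.of k N g • w) := by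
      rw [smul_smul, smul_smul, mul_assoc (MonoidAlgebra.of k N g * x), ← map_mul,
        inv_mul_cancel, map_one, mul_one]
    rw [e]
    exact Submodule.smul_mem_smul (I.conj_mem g x hx)
      (smul_mem_generatedSub (of_mem_groupSubalgebra hg) hw)
  · rw [smul_add]; exact add_mem hx hy

/-- The kernel of reduction is spanned by elements `(h - 1) g` with `h ∈ I†`, and `h - 1 ∈ I` by
definition of `I†`. Thus on `U / I U` only the image in `k[N / I†]` matters. -/
theorem smul_mem_ideal_smul_of_reduction_eq_zero {x : MonoidAlgebra k N}
    (hx : x ∈ groupSubalgebra k L) (h0 : reduction k I.dagger x = 0) {u : W}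
    (hu : u ∈ generatedSub k L S) : x • u ∈ I.carrier • generatedSub k L S := by
  refine Submodule.span_induction (p := fun x _ => x • u ∈ I.carrier • generatedSub k L S)
    ?_ (by simp) (fun x y _ _ hx hy => by rw [add_smul]; exact add_mem hx hy)
    (fun c x _ hx => by rw [smul_assoc]; exact Submodule.smul_mem _ _ hx)
    (mem_span_of_reduction_eq_zero I.dagger L hx h0)
  rintro _ ⟨h, ⟨hh, _⟩, g, hg, rfl⟩
  rw [mul_smul]
  exact Submodule.smul_mem_smul hh (smul_mem_generatedSub (of_mem_groupSubalgebra hg) hu)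

/-- An element of `kL` that is central modulo `I†` maps the `kL`-submodule `U` generated by `S`
into `I U` if it does so for the elements of `S`. -/
theorem smul_mem_ideal_smul_of_isCentralModulo {x : MonoidAlgebra k N}
    (hx : x ∈ groupSubalgebra k L) (hxc : IsCentralModulo I.dagger x)
    (h : ∀ s ∈ S, x • s ∈ I.carrier • generatedSub k L S) {u : W} (hu : u ∈ generatedSub k L S) :
    x • u ∈ I.carrier • generatedSub k L S := by
  refine Submodule.smul_induction_on hu (fun r hr w hw => ?_)
    (fun x y hx hy => by rw [smul_add]; exact add_mem hx hy)
  have hw' : x • w ∈ I.carrier • generatedSub k L S := by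
    refine Submodule.span_induction (p := fun w _ => x • w ∈ I.carrier • generatedSub k L S)
      h (by simp) (fun u v _ _ hu hv => by rw [smul_add]; exact add_mem hu hv)
      (fun c u _ hu => ?_) hw
    rw [smul_comm]; exact Submodule.smul_mem _ _ hu
  have e : x • r • w = r • x • w + (x * r - r * x) • w := by
    rw [sub_smul, mul_smul, mul_smul]; abel
  rw [e]
  refine add_mem (smul_mem_ideal_smul hr hw') (smul_mem_ideal_smul_of_reduction_eq_zero
    (sub_mem (mul_mem hx hr) (mul_mem hr hx)) ?_ (span_le_generatedSub hw))
  rw [map_sub, hxc r, sub_self]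

theorem exists_finset_forall_mem_span {u : W} (hu : u ∈ generatedSub k L S) :
    ∃ T : Finset N, (T : Set N) ⊆ L ∧
      ∀ G : Subgroup N, (T : Set N) ⊆ G → u ∈ Submodule.span (groupSubalgebra k G) S := by
  classical
  refine Submodule.smul_induction_on hu (fun r hr w hw => ?_) (fun x y hx hy => ?_)
  · obtain ⟨T, hTL, hT⟩ := exists_finset_forall_mem_groupSubalgebra hr
    exact ⟨T, hTL, fun G hG => Submodule.smul_mem _ (⟨r, hT G hG⟩ : groupSubalgebra k G)
      (Submodule.span_subset_span k _ S hw)⟩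
  · obtain ⟨T, hTL, hT⟩ := hx
    obtain ⟨T', hTL', hT'⟩ := hy
    refine ⟨T ∪ T', by simp [hTL, hTL'], fun G hG => ?_⟩
    rw [Finset.coe_union, Set.union_subset_iff] at hG
    exact add_mem (hT G hG.1) (hT' G hG.2)

/-- Passage from `L` down to `G`. An expression of `u` uses finitely many group elements, and each
element of `I` is fixed by `e` modulo `I†`, so over `G` the ideal `fixedIdeal he G` can play the
role of `I`. -/
theorem exists_finset_forall_mem_fixedIdeal_smul_span {e : MonoidAlgebra k N}
    (he : IsCentralModulo I.dagger e)
    (heI : ∀ x ∈ I.carrier, reduction k I.dagger (e * x) = reduction k I.dagger x)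
    (hKL : K ≤ L) {u : W} (hu : u ∈ I.carrier • generatedSub k L S) :
    ∃ T : Finset N, (T : Set N) ⊆ L ∧ ∀ G : Subgroup N, (T : Set N) ⊆ G →
      u ∈ fixedIdeal he G • Submodule.span (groupSubalgebra k G) S := by
  classical
  refine Submodule.smul_induction_on hu (fun r hr w hw => ?_) (fun x y hx hy => ?_)
  · obtain ⟨T, hTL, hT⟩ := exists_finset_forall_mem_groupSubalgebra
      (groupSubalgebra_mono hKL (I.le_groupRing hr))
    obtain ⟨T', hTL', hT'⟩ := exists_finset_forall_mem_span hw
    refine ⟨T ∪ T', by simp [hTL, hTL'], fun G hG => ?_⟩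
    rw [Finset.coe_union, Set.union_subset_iff] at hG
    exact Submodule.smul_mem_smul (r := (⟨r, hT G hG.1⟩ : groupSubalgebra k G))
      (mem_fixedIdeal.2 (heI r hr)) (hT' G hG.2)
  · obtain ⟨T, hTL, hT⟩ := hx
    obtain ⟨T', hTL', hT'⟩ := hy
    refine ⟨T ∪ T', by simp [hTL, hTL'], fun G hG => ?_⟩
    rw [Finset.coe_union, Set.union_subset_iff] at hG
    exact add_mem (hT G hG.1) (hT' G hG.2)

theorem smul_mem_fixedIdeal_smul {e : MonoidAlgebra k N} (he : IsCentralModulo I.dagger e)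
    {G : Subgroup N} {x : groupSubalgebra k G} (hxc : IsCentralModulo I.dagger (x : MonoidAlgebra k N))
    (h : ∀ s ∈ S, x • s ∈ fixedIdeal he G • Submodule.span (groupSubalgebra k G) S) {u : W}
    (hu : u ∈ Submodule.span (groupSubalgebra k G) S) :
    x • u ∈ fixedIdeal he G • Submodule.span (groupSubalgebra k G) S := by
  refine Submodule.span_induction
    (p := fun u _ => x • u ∈ fixedIdeal he G • Submodule.span (groupSubalgebra k G) S)
    h (by simp) (fun u v _ _ hu hv => by rw [smul_add]; exact add_mem hu hv)
    (fun r u hu' hu => ?_) hu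
  have e' : x • r • u = r • x • u + (x * r - r * x) • u := by
    rw [sub_smul, mul_smul, mul_smul]; abel
  rw [e']
  refine add_mem (Submodule.smul_mem _ _ hu) (Submodule.smul_mem_smul ?_ hu')
  have h0 : reduction k I.dagger ((x * r - r * x : groupSubalgebra k G) : MonoidAlgebra k N) = 0 := by
    rw [Subalgebra.coe_sub, Subalgebra.coe_mul, Subalgebra.coe_mul, map_sub, hxc r, sub_self]
  rw [mem_fixedIdeal, map_mul, h0, mul_zero]

/-- Passage back from `G` to `L`, by splitting `r u = e (r u) + (r - e r) u`: the first term is in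
`I U` because `e ∈ I`, the second because `r - e r` vanishes modulo `I†`. -/
theorem fixedIdeal_smul_span_singleton_le {e : MonoidAlgebra k N} (heI : e ∈ I.carrier)
    (hec : IsCentralModulo I.dagger e) {G : Subgroup N} (hGL : G ≤ L)
    (heG : e ∈ groupSubalgebra k G) {b u : W}
    (hu : u ∈ fixedIdeal hec G • Submodule.span (groupSubalgebra k G) {b}) :
    u ∈ I.carrier • generatedSub k L {b} := by
  refine Submodule.smul_induction_on hu (fun r hr u hu => ?_) fun u v hu hv => add_mem hu hv
  have hu' : u ∈ generatedSub k L {b} := by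
    obtain ⟨c, rfl⟩ := Submodule.mem_span_singleton.1 hu
    exact smul_mem_generatedSub (groupSubalgebra_mono hGL c.2) (subset_generatedSub rfl)
  have hrL : (r : MonoidAlgebra k N) ∈ groupSubalgebra k L := groupSubalgebra_mono hGL r.2
  have e1 : (r : MonoidAlgebra k N) • u = e • ((r : MonoidAlgebra k N) • u) +
      ((r : MonoidAlgebra k N) - e * r) • u := by
    rw [sub_smul, mul_smul]
    exact (add_sub_cancel _ _).symm
  change (r : MonoidAlgebra k N) • u ∈ _
  rw [e1]
  refine add_mem (Submodule.smul_mem_smul heI (smul_mem_generatedSub hrL hu'))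
    (smul_mem_ideal_smul_of_reduction_eq_zero
      (sub_mem hrL (mul_mem (groupSubalgebra_mono hGL heG) hrL)) ?_ hu')
  rw [map_sub, sub_eq_zero]
  exact (mem_fixedIdeal.1 hr).symm

/-- The polycentral Artin–Rees argument with `J` the fixed ideal of `e` and `C₀` the kernel of
reduction on `kG`. -/
theorem exists_pow_smul_mem_fixedIdeal_smul_span [Group.IsNilpotent N] {e : MonoidAlgebra k N}
    (hec : IsCentralModulo I.dagger e)
    (heid : reduction k I.dagger (e * e) = reduction k I.dagger e)
    {G : Subgroup N} (hG : G.FG) (heG : e ∈ groupSubalgebra k G) (hS : S.Finite)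
    {x : groupSubalgebra k G} (hxc : IsCentralModulo I.dagger (x : MonoidAlgebra k N))
    (hx : ∀ s ∈ S, x • s ∈ fixedIdeal hec G • Submodule.span (groupSubalgebra k G) S) {b : W}
    (hb : b ∈ Submodule.span (groupSubalgebra k G) S) :
    ∃ m : ℕ, x ^ m • b ∈ fixedIdeal hec G • Submodule.span (groupSubalgebra k G) {b} := by
  have hnoeth : IsNoetherianRing (groupSubalgebra k G) := isNoetherianRing_groupSubalgebra hG
  refine exists_pow_smul_mem_smul_span_of_polycentral
    (C₀ := reductionKer k I.dagger G) (fun r hr => ?_) (e := ⟨e, heG⟩) x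
    (mem_fixedIdeal.2 heid) (fun r hr => ?_) (fun r => ?_)
    (fun C hC hlt => exists_central_of_lt_reductionKer hC hlt) hS
    (fun u hu => smul_mem_fixedIdeal_smul hec hxc hx hu) hb
  · rw [mem_fixedIdeal, map_mul, mem_reductionKer.1 hr, mul_zero]
  · rw [mem_reductionKer, Subalgebra.coe_sub, map_sub, sub_eq_zero]
    exact (mem_fixedIdeal.1 hr).symm
  · rw [mem_reductionKer, Subalgebra.coe_sub, Subalgebra.coe_mul, Subalgebra.coe_mul, map_sub,
      sub_eq_zero]
    exact hec r

/-- Let `U` be a finitely generated `kL`-submodule and let `x ∈ kL` be central modulo `I†`. If `x`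
annihilates `U / I U`, then a power of `x` annihilates `U' / I U'` for each cyclic submodule `U'`
of `U`. -/
theorem exists_pow_smul_mem_ideal_smul [Group.IsNilpotent N] [CharZero k]
    (hI : Finite (↥K ⧸ I.dagger.subgroupOf K)) (hKL : K ≤ L) (S : Finset W)
    {x : MonoidAlgebra k N} (hx : x ∈ groupSubalgebra k L) (hxc : IsCentralModulo I.dagger x)
    (hxS : ∀ s ∈ S, x • s ∈ I.carrier • generatedSub k L (S : Set W)) {b : W}
    (hb : b ∈ generatedSub k L (S : Set W)) :
    ∃ m : ℕ, x ^ m • b ∈ I.carrier • generatedSub k L {b} := by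
  classical
  obtain ⟨e, heI, hec, heid⟩ := I.exists_central_idempotent hI
  replace hec : IsCentralModulo I.dagger e := hec
  obtain ⟨T₁, hT₁L, hT₁⟩ := exists_finset_forall_mem_groupSubalgebra hx
  obtain ⟨T₂, hT₂L, hT₂⟩ := exists_finset_forall_mem_groupSubalgebra
    (groupSubalgebra_mono hKL (I.le_groupRing heI))
  obtain ⟨T₃, hT₃L, hT₃⟩ := exists_finset_forall_mem_span hb
  have h4 : ∀ s : S, ∃ T : Finset N, (T : Set N) ⊆ L ∧ ∀ G : Subgroup N, (T : Set N) ⊆ G →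
      x • (s : W) ∈ fixedIdeal hec G • Submodule.span (groupSubalgebra k G) (S : Set W) :=
    fun s => exists_finset_forall_mem_fixedIdeal_smul_span hec heid hKL (hxS s s.2)
  choose T₄ hT₄L hT₄ using h4
  -- `G` is generated by all group elements needed to express `x`, `e`, `b` and the relations `x s ∈
  -- I U`.
  obtain ⟨T, hT⟩ : ∃ T, T = T₁ ∪ T₂ ∪ T₃ ∪ Finset.univ.biUnion T₄ := ⟨_, rfl⟩
  have hTL : (T : Set N) ⊆ L := by
    simp only [hT, Finset.coe_union, Finset.coe_biUnion, Set.union_subset_iff,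
      Set.iUnion_subset_iff]
    exact ⟨⟨⟨hT₁L, hT₂L⟩, hT₃L⟩, fun s _ => hT₄L s⟩
  obtain ⟨G, hG⟩ : ∃ G, G = Subgroup.closure (T : Set N) := ⟨_, rfl⟩
  have hTG : (T : Set N) ⊆ G := hG ▸ Subgroup.subset_closure
  have hGL : G ≤ L := hG ▸ (Subgroup.closure_le _).2 hTL
  simp only [hT, Finset.coe_union, Finset.coe_biUnion, Set.union_subset_iff,
    Set.iUnion_subset_iff] at hTG
  obtain ⟨⟨⟨h1, h2⟩, h3⟩, h4⟩ := hTG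
  obtain ⟨m, hm⟩ := exists_pow_smul_mem_fixedIdeal_smul_span hec (heid e heI) ⟨T, hG.symm⟩
    (hT₂ G h2) S.finite_toSet (x := ⟨x, hT₁ G h1⟩) hxc
    (fun s hs => hT₄ ⟨s, hs⟩ G (h4 ⟨s, hs⟩ (Finset.mem_univ _))) (hT₃ G h3)
  exact ⟨m, fixedIdeal_smul_span_singleton_le heI hec hGL (hT₂ G h2) hm⟩

end Module

end LocalIdeal

/-! ### Dense subgroups of abelian groups and contractions of prime ideals -/

section DenseSubgroups

variable {B : Type*} [CommGroup B]

theorem Subgroup.FG.of_le_of_comm {H H' : Subgroup B} (hle : H ≤ H') (hH' : H'.FG) : H.FG := by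
  have h1 : Group.FG H' := (Group.fg_iff_subgroup_fg H').2 hH'
  have h2 : Module.Finite ℤ (Additive H') := Module.Finite.iff_addGroup_fg.2 inferInstance
  have h3 : (AddSubgroup.toIntSubmodule (Subgroup.toAddSubgroup (H.subgroupOf H'))).FG :=
    IsNoetherian.noetherian _
  rw [Submodule.fg_iff_addSubgroup_fg] at h3
  have h4 : (H.subgroupOf H').FG := (Subgroup.fg_iff_add_fg _).2 h3
  have h5 : ((H.subgroupOf H').map H'.subtype).FG := by
    have : Group.FG (H.subgroupOf H') := (Group.fg_iff_subgroup_fg _).2 h4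
    exact (Group.fg_iff_subgroup_fg _).1 (Group.fg_of_surjective
      (H'.subtype.subgroupMap_surjective (H.subgroupOf H')))
  rwa [Subgroup.subgroupOf_map_subtype, inf_eq_left.2 hle] at h5

theorem Subgroup.FG.map_of_monoidHom {G G' : Type*} [Group G] [Group G'] {H : Subgroup G}
    (hH : H.FG) (f : G →* G') : (H.map f).FG := by
  have : Group.FG H := (Group.fg_iff_subgroup_fg _).2 hH
  exact (Group.fg_iff_subgroup_fg _).1 (Group.fg_of_surjective (f.subgroupMap_surjective H))

theorem Subgroup.FG.of_map_injective {G G' : Type*} [Group G] [Group G'] {H : Subgroup G}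
    {f : G →* G'} (hf : Function.Injective f) (hH : (H.map f).FG) : H.FG := by
  have : Group.FG (H.map f) := (Group.fg_iff_subgroup_fg _).2 hH
  exact (Group.fg_iff_subgroup_fg _).1
    (Group.fg_of_surjective (f := (H.equivMapOfInjective f hf).symm.toMonoidHom)
      (H.equivMapOfInjective f hf).symm.surjective)

theorem exists_finset_transversal {H H' : Subgroup B} (hH' : H'.FG)
    (h : ∀ b ∈ H', ∃ n : ℕ, 0 < n ∧ b ^ n ∈ H) :
    ∃ T : Finset B, (T : Set B) ⊆ H' ∧ ∀ b ∈ H', ∃ t ∈ T, b * t⁻¹ ∈ H := by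
  classical
  set Q := H'.map (QuotientGroup.mk' H)
  have : Group.FG Q := (Group.fg_iff_subgroup_fg _).2 (hH'.map_of_monoidHom _)
  have hfin : Finite Q := by
    refine CommGroup.finite_of_fg_isMulTorsion Q ?_
    rintro ⟨_, b, hb, rfl⟩
    obtain ⟨n, hn, hbn⟩ := h b hb
    refine isOfFinOrder_iff_pow_eq_one.2 ⟨n, hn, Subtype.ext ?_⟩
    exact (QuotientGroup.eq_one_iff (b ^ n)).2 hbn
  have hs : ∀ q : Q, ∃ b ∈ H', (b : B ⧸ H) = q := fun ⟨_, b, hb, h⟩ => ⟨b, hb, h⟩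
  choose s hs hsq using hs
  have := Fintype.ofFinite Q
  refine ⟨Finset.univ.image s, ?_, fun b hb => ?_⟩
  · intro t ht
    obtain ⟨q, -, rfl⟩ := Finset.mem_image.1 (Finset.mem_coe.1 ht)
    exact hs q
  · refine ⟨s ⟨(b : B ⧸ H), b, hb, rfl⟩, Finset.mem_image_of_mem _ (Finset.mem_univ _), ?_⟩
    rw [← QuotientGroup.eq_one_iff, QuotientGroup.mk_mul, QuotientGroup.mk_inv, hsq,
      mul_inv_cancel]

theorem IsDenseSubgroup.inf {G : Type*} [Group G] {H H' : Subgroup G} (h : IsDenseSubgroup H)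
    (h' : IsDenseSubgroup H') : IsDenseSubgroup (H ⊓ H') := fun g => by
  obtain ⟨m, hm, hg⟩ := h g
  obtain ⟨n, hn, hg'⟩ := h' g
  refine ⟨m * n, Nat.mul_pos hm hn, ?_, ?_⟩
  · rw [pow_mul]; exact H.pow_mem hg n
  · rw [mul_comm, pow_mul]; exact H'.pow_mem hg' m

theorem IsDenseSubgroup.mono {G : Type*} [Group G] {H H' : Subgroup G} (h : IsDenseSubgroup H)
    (hle : H ≤ H') : IsDenseSubgroup H' := fun g =>
  let ⟨n, hn, hg⟩ := h g
  ⟨n, hn, hle hg⟩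

theorem IsDenseSubgroup.of_finiteIndex {G : Type*} [Group G] {H : Subgroup G} (h : H.FiniteIndex) :
    IsDenseSubgroup H := fun g =>
  let ⟨n, hn, _, hg⟩ := Subgroup.exists_pow_mem_of_index_ne_zero h.index_ne_zero g
  ⟨n, hn, hg⟩

theorem IsDenseSubgroup.finiteIndex {H : Subgroup B} [Group.FG B] (h : IsDenseSubgroup H) :
    H.FiniteIndex := by
  have : Finite (B ⧸ H) := by
    refine CommGroup.finite_of_fg_isMulTorsion _ fun q => ?_
    obtain ⟨b, rfl⟩ := QuotientGroup.mk_surjective q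
    obtain ⟨n, hn, hbn⟩ := h b
    exact isOfFinOrder_iff_pow_eq_one.2 ⟨n, hn, (QuotientGroup.eq_one_iff (b ^ n)).2 hbn⟩
  exact Subgroup.finiteIndex_of_finite_quotient

end DenseSubgroups

/-! ### Integrality and lying over for dense subgroups; equivalence of primes -/

section Contraction

variable {k : Type*} [Field k]

theorem isNoetherianRing_monoidAlgebra_of_fg_of_comm {Y : Type*} [CommGroup Y] [Group.FG Y] :
    IsNoetherianRing (MonoidAlgebra k Y) :=
  isNoetherianRing_monoidAlgebra_of_fg_of_isNilpotent k

/-- A group element `y` is a root of `T ^ n - x`, where `x` maps to `y ^ n`. This yields lying over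
for dense subgroups. -/
theorem isIntegral_mapDomainRingHom {X Y : Type*} [CommGroup X] [CommGroup Y] {f : X →* Y}
    (hf : ∀ y, ∃ n : ℕ, 0 < n ∧ y ^ n ∈ f.range) :
    (MonoidAlgebra.mapDomainRingHom k f).IsIntegral := by
  intro z
  induction z using MonoidAlgebra.induction_linear with
  | zero => exact RingHom.isIntegralElem_zero _
  | add x y hx hy => exact RingHom.IsIntegralElem.add _ hx hy
  | single y c =>
    obtain ⟨n, hn, x, hx⟩ := hf y
    have h1 : (MonoidAlgebra.mapDomainRingHom k f).IsIntegralElem (MonoidAlgebra.single y 1) := by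
      refine ⟨Polynomial.X ^ n - Polynomial.C (MonoidAlgebra.single x 1),
        Polynomial.monic_X_pow_sub_C _ hn.ne', ?_⟩
      rw [Polynomial.eval₂_sub, Polynomial.eval₂_pow, Polynomial.eval₂_X, Polynomial.eval₂_C,
        MonoidAlgebra.single_pow, MonoidAlgebra.mapDomainRingHom_apply,
        MonoidAlgebra.mapDomain_single, hx, one_pow, sub_self]
    have h2 : (MonoidAlgebra.mapDomainRingHom k f).IsIntegralElem (MonoidAlgebra.single 1 c) := by
      have := RingHom.isIntegralElem_map (MonoidAlgebra.mapDomainRingHom k f)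
        (x := MonoidAlgebra.single 1 c)
      rwa [MonoidAlgebra.mapDomainRingHom_apply, MonoidAlgebra.mapDomain_single, map_one] at this
    have h3 := RingHom.IsIntegralElem.mul _ h2 h1
    rwa [MonoidAlgebra.single_mul_single, one_mul, mul_one] at h3

theorem exists_comap_mapDomainRingHom_eq {X Y : Type*} [CommGroup X] [CommGroup Y] {f : X →* Y}
    (hinj : Function.Injective f) (hf : ∀ y, ∃ n : ℕ, 0 < n ∧ y ^ n ∈ f.range)
    (P : PrimeSpectrum (MonoidAlgebra k X)) :
    ∃ Q, PrimeSpectrum.comap (MonoidAlgebra.mapDomainRingHom k f) Q = P :=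
  (isIntegral_mapDomainRingHom hf).comap_surjective (MonoidAlgebra.mapDomain_injective hinj) P

theorem comap_comap_mapDomainRingHom {X Y Z : Type*} [CommGroup X] [CommGroup Y] [CommGroup Z]
    (f : Y →* Z) (g : X →* Y) (P : Ideal (MonoidAlgebra k Z)) :
    (P.comap (MonoidAlgebra.mapDomainRingHom k f)).comap (MonoidAlgebra.mapDomainRingHom k g) =
      P.comap (MonoidAlgebra.mapDomainRingHom k (f.comp g)) := by
  rw [Ideal.comap_comap, MonoidAlgebra.mapDomainRingHom_comp]

variable {A : Type*} [CommGroup A]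

theorem PrimesEquivalent.symm {P Q : PrimeSpectrum (MonoidAlgebra k A)}
    (h : PrimesEquivalent P Q) : PrimesEquivalent Q P :=
  let ⟨B, h1, h2, h3⟩ := h
  ⟨B, h1, h2, h3.symm⟩

theorem PrimesEquivalent.trans {P Q R : PrimeSpectrum (MonoidAlgebra k A)}
    (h : PrimesEquivalent P Q) (h' : PrimesEquivalent Q R) : PrimesEquivalent P R := by
  obtain ⟨B, h1, h2, h3⟩ := h
  obtain ⟨B', h1', h2', h3'⟩ := h'
  refine ⟨B ⊓ B', h1.of_le_of_comm inf_le_left, h2.inf h2', ?_⟩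
  have e1 : (B ⊓ B').subtype = B.subtype.comp (Subgroup.inclusion inf_le_left) := rfl
  have e2 : (B ⊓ B').subtype = B'.subtype.comp (Subgroup.inclusion inf_le_right) := rfl
  rw [e1, ← comap_comap_mapDomainRingHom, h3, comap_comap_mapDomainRingHom, ← e1, e2,
    ← comap_comap_mapDomainRingHom, h3', comap_comap_mapDomainRingHom]

theorem primeClass_eq_of_primesEquivalent {P Q : PrimeSpectrum (MonoidAlgebra k A)}
    (h : PrimesEquivalent P Q) : primeClass P = primeClass Q :=
  Set.ext fun _ => ⟨fun h' => h.symm.trans h', fun h' => h.trans h'⟩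

end Contraction

/-! ### Stable subgroups and the classes attached to them -/

section Stable

variable {k : Type*} [Field k] {M : Type*} [AddCommGroup M] [Module k M]

theorem mem_annihilator_asModule {Γ : Type*} [CommGroup Γ] (σ : Representation k Γ M)
    {f : MonoidAlgebra k Γ} :
    f ∈ Module.annihilator (MonoidAlgebra k Γ) σ.asModule ↔ ∀ m, σ.asAlgebraHom f m = 0 := by
  rw [Module.mem_annihilator]
  exact ⟨fun h m => h (σ.asModuleEquiv.symm m), fun h m => h (σ.asModuleEquiv m)⟩

theorem annihilator_comp {Γ Δ : Type*} [CommGroup Γ] [CommGroup Δ] (σ : Representation k Γ M)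
    (f : Δ →* Γ) : Module.annihilator (MonoidAlgebra k Δ) (Representation.asModule (σ.comp f)) =
      (Module.annihilator (MonoidAlgebra k Γ) σ.asModule).comap
        (MonoidAlgebra.mapDomainRingHom k f) := by
  have h : ∀ x, Representation.asAlgebraHom (σ.comp f) x =
      σ.asAlgebraHom (MonoidAlgebra.mapDomainRingHom k f x) := fun x => by
    induction x using MonoidAlgebra.induction_linear with
    | zero => simp
    | add x y hx hy => rw [map_add, map_add, map_add, hx, hy]
    | single d c => simp [Representation.asAlgebraHom_single]
  ext x
  rw [mem_annihilator_asModule, Ideal.mem_comap, mem_annihilator_asModule]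
  simp only [h]

/-- The annihilator over `kΔ` is the contraction of the one over `kΓ`, and a prime minimal over a
contracted ideal is the contraction of a minimal prime. -/
theorem exists_mapDomain_comap_eq_of_mem_minimalOverAnnihilator {Γ Δ : Type*} [CommGroup Γ]
    [CommGroup Δ] (σ : Representation k Γ M) (f : Δ →* Γ)
    {P : Ideal (MonoidAlgebra k Δ)} (hP : P ∈ minimalOverAnnihilator (σ.comp f)) :
    ∃ P' ∈ minimalOverAnnihilator σ, P'.comap (MonoidAlgebra.mapDomainRingHom k f) = P := by
  rw [minimalOverAnnihilator, annihilator_comp] at hP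
  exact Ideal.exists_minimalPrimes_comap_eq _ P hP

theorem finite_minimalOverAnnihilator {Γ : Type*} [CommGroup Γ] [Group.FG Γ]
    (σ : Representation k Γ M) : (minimalOverAnnihilator σ).Finite := by
  have := isNoetherianRing_monoidAlgebra_of_fg_of_comm (k := k) (Y := Γ)
  exact Ideal.finite_minimalPrimes_of_isNoetherianRing _ _

/-- Choose a subgroup of finite index with the least number of minimal primes. -/
theorem exists_isStableSubgroup {Γ : Type*} [CommGroup Γ] [Group.FG Γ]
    (σ : Representation k Γ M) : ∃ C : Subgroup Γ, IsStableSubgroup σ C := by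
  classical
  have hfg : ∀ C : Subgroup Γ, C.FG := fun C =>
    Subgroup.FG.of_le_of_comm le_top (Group.fg_def.1 inferInstance)
  have hex : ∃ n, ∃ C : Subgroup Γ, C.FiniteIndex ∧
      (minimalOverAnnihilator (σ.comp C.subtype)).ncard = n := ⟨_, ⊤, inferInstance, rfl⟩
  obtain ⟨C, hC, hn⟩ := Nat.find_spec hex
  refine ⟨C, hfg C, .of_finiteIndex hC, fun X hX => ?_⟩
  have hCfg : Group.FG C := (Group.fg_iff_subgroup_fg _).2 (hfg C)
  set S := minimalOverAnnihilator (σ.comp C.subtype)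
  set T := minimalOverAnnihilator ((σ.comp C.subtype).comp X.subtype)
  set φ := Ideal.comap (MonoidAlgebra.mapDomainRingHom k X.subtype)
  have hS : S.Finite := finite_minimalOverAnnihilator _
  have hT : T ⊆ φ '' S := fun P hP =>
    let ⟨P', h1, h2⟩ := exists_mapDomain_comap_eq_of_mem_minimalOverAnnihilator _ X.subtype hP
    ⟨P', h1, h2⟩
  -- `X` also has finite index in `Γ`, so the minimality of `C` applies to it, once it is viewed as
  -- the subgroup `X.map C.subtype` of `Γ`.
  have hcard : S.ncard ≤ T.ncard := by
    have hX' : (X.map C.subtype).FiniteIndex := by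
      refine IsDenseSubgroup.finiteIndex fun g => ?_
      obtain ⟨m, hm, hgm⟩ := IsDenseSubgroup.of_finiteIndex hC g
      obtain ⟨n, hn, hgn⟩ := IsDenseSubgroup.of_finiteIndex hX ⟨g ^ m, hgm⟩
      refine ⟨m * n, Nat.mul_pos hm hn, ⟨⟨g ^ m, hgm⟩ ^ n, hgn, ?_⟩⟩
      simp [pow_mul]
    have h1 := Nat.find_min' hex ⟨X.map C.subtype, hX', rfl⟩
    rw [← hn] at h1
    refine h1.trans ?_
    have : Group.FG X := by
      rw [Group.fg_iff_subgroup_fg]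
      exact Subgroup.FG.of_le_of_comm le_top (Group.fg_def.1 inferInstance)
    have hTfin : T.Finite := finite_minimalOverAnnihilator _
    set ε := X.equivMapOfInjective C.subtype C.subtype_injective
    have e : (σ.comp C.subtype).comp X.subtype =
        (σ.comp (X.map C.subtype).subtype).comp ε.toMonoidHom := rfl
    have h2 : minimalOverAnnihilator (σ.comp (X.map C.subtype).subtype) ⊆
        (Ideal.comap (MonoidAlgebra.mapDomainRingHom k ε.symm.toMonoidHom)) '' T := by
      intro P hP
      have e' : σ.comp (X.map C.subtype).subtype =
          ((σ.comp C.subtype).comp X.subtype).comp ε.symm.toMonoidHom := by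
        rw [e, MonoidHom.comp_assoc]
        ext x : 1
        simp
      rw [e'] at hP
      obtain ⟨P', h1, h2⟩ := exists_mapDomain_comap_eq_of_mem_minimalOverAnnihilator _ _ hP
      exact ⟨P', h1, h2⟩
    exact (Set.ncard_le_ncard h2 (hTfin.image _)).trans (Set.ncard_image_le hTfin)
  -- From `T ⊆ φ '' S` and `|φ '' S| ≤ |S| ≤ |T|` all cardinalities agree, which gives both
  -- surjectivity and injectivity.
  have hTimg : T = φ '' S := Set.eq_of_subset_of_ncard_le hT
    ((Set.ncard_image_le hS).trans hcard) (hS.image _)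
  refine ⟨fun P hP => hTimg ▸ ⟨P, hP, rfl⟩, ?_, fun P hP => hTimg ▸ hP⟩
  refine Set.injOn_of_ncard_image_eq (le_antisymm (Set.ncard_image_le hS) ?_) hS
  rw [← hTimg]
  exact hcard

/-- The support of a finitely generated module is the zero locus of its annihilator. -/
theorem mem_minimalSupport_iff {Γ : Type*} [CommGroup Γ] {σ : Representation k Γ M}
    (hfin : Module.Finite (MonoidAlgebra k Γ) σ.asModule)
    {P : PrimeSpectrum (MonoidAlgebra k Γ)} :
    P ∈ minimalSupport σ ↔ P.asIdeal ∈ minimalOverAnnihilator σ := by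
  have h : ∀ Q : PrimeSpectrum (MonoidAlgebra k Γ),
      Q ∈ Module.support (MonoidAlgebra k Γ) σ.asModule ↔
        Module.annihilator (MonoidAlgebra k Γ) σ.asModule ≤ Q.asIdeal := fun Q => by
    rw [Module.support_eq_zeroLocus, PrimeSpectrum.mem_zeroLocus]; rfl
  constructor
  · rintro ⟨h1, h2⟩
    exact ⟨⟨P.2, (h P).1 h1⟩, fun Q hQ hQP => h2 (y := ⟨Q, hQ.1⟩) ((h _).2 hQ.2) hQP⟩
  · rintro ⟨⟨_, h1⟩, h2⟩
    exact ⟨(h P).2 h1, fun Q hQ hQP => h2 (y := Q.asIdeal) ⟨Q.2, (h Q).1 hQ⟩ hQP⟩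

variable {A : Type*} [CommGroup A] {Γ : Subgroup A} {σ : Representation k Γ M} {C : Subgroup Γ}

/-- The classes of primes attached to a stable subgroup can be computed over each smaller finitely
generated dense subgroup. -/
theorem IsStableSubgroup.classesOver_eq (hC : IsStableSubgroup σ C)
    (hfin : Module.Finite (MonoidAlgebra k C) (Representation.asModule (σ.comp C.subtype)))
    {X : Subgroup A} (hXfg : X.FG) (hX : IsDenseSubgroup X) (hXΓ : X ≤ Γ)
    (hXC : X ≤ C.map Γ.subtype) :
    classesOver (Γ.subtype.comp C.subtype) (minimalSupport (σ.comp C.subtype)) =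
      {c | ∃ Q : PrimeSpectrum (MonoidAlgebra k A),
        Q.asIdeal.comap (MonoidAlgebra.mapDomainRingHom k X.subtype) ∈
          minimalOverAnnihilator (σ.comp (Subgroup.inclusion hXΓ)) ∧ c = primeClass Q} := by
  have hCfg : Group.FG C := (Group.fg_iff_subgroup_fg _).2 hC.fg
  set ι : C →* A := Γ.subtype.comp C.subtype with hι
  have hιinj : Function.Injective ι := Γ.subtype_injective.comp C.subtype_injective
  set X' : Subgroup C := X.comap ι with hX'
  have hX'fin : X'.FiniteIndex := IsDenseSubgroup.finiteIndex fun c => by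
    obtain ⟨n, hn, hc⟩ := hX (ι c)
    exact ⟨n, hn, by rwa [hX', Subgroup.mem_comap, map_pow]⟩
  have hιdense : ∀ g, ∃ n : ℕ, 0 < n ∧ g ^ n ∈ ι.range := fun g => by
    obtain ⟨n, hn, h⟩ := hX g
    obtain ⟨y, hy, hyg⟩ := hXC h
    exact ⟨n, hn, ⟨y, hy⟩, hyg⟩
  let u : X →* X' :=
    { toFun := fun x => ⟨⟨⟨x, hXΓ x.2⟩, by
          obtain ⟨y, hy, hyx⟩ := hXC x.2
          rwa [show (⟨x, hXΓ x.2⟩ : Γ) = y from Subtype.ext hyx.symm]⟩, x.2⟩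
      map_one' := rfl
      map_mul' := fun _ _ => rfl }
  let v : X' →* X :=
    { toFun := fun x => ⟨ι x, x.2⟩
      map_one' := rfl
      map_mul' := fun _ _ => rfl }
  have hu : σ.comp (Subgroup.inclusion hXΓ) = ((σ.comp C.subtype).comp X'.subtype).comp u := rfl
  have hv : (σ.comp C.subtype).comp X'.subtype = (σ.comp (Subgroup.inclusion hXΓ)).comp v := rfl
  have huv : u.comp v = MonoidHom.id _ := rfl
  have hvu : v.comp u = MonoidHom.id _ := rfl
  have hid : ∀ {Y : Type _} [CommGroup Y] (P : Ideal (MonoidAlgebra k Y)),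
      P.comap (MonoidAlgebra.mapDomainRingHom k (MonoidHom.id Y)) = P := fun P => by
    rw [MonoidAlgebra.mapDomainRingHom_id, Ideal.comap_id]
  have hmin : ∀ P : Ideal (MonoidAlgebra k A),
      P.comap (MonoidAlgebra.mapDomainRingHom k X.subtype) ∈
        minimalOverAnnihilator (σ.comp (Subgroup.inclusion hXΓ)) ↔
      (P.comap (MonoidAlgebra.mapDomainRingHom k ι)).comap
        (MonoidAlgebra.mapDomainRingHom k X'.subtype) ∈
        minimalOverAnnihilator ((σ.comp C.subtype).comp X'.subtype) := by
    intro P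
    have e1 : (P.comap (MonoidAlgebra.mapDomainRingHom k X.subtype)).comap
        (MonoidAlgebra.mapDomainRingHom k v) = (P.comap (MonoidAlgebra.mapDomainRingHom k ι)).comap
        (MonoidAlgebra.mapDomainRingHom k X'.subtype) := by
      rw [comap_comap_mapDomainRingHom, comap_comap_mapDomainRingHom]; rfl
    have e2 : ((P.comap (MonoidAlgebra.mapDomainRingHom k ι)).comap
        (MonoidAlgebra.mapDomainRingHom k X'.subtype)).comap (MonoidAlgebra.mapDomainRingHom k u) =
        P.comap (MonoidAlgebra.mapDomainRingHom k X.subtype) := by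
      rw [comap_comap_mapDomainRingHom, comap_comap_mapDomainRingHom]; rfl
    constructor
    · intro h
      rw [hu] at h
      obtain ⟨P', h1, h2⟩ := exists_mapDomain_comap_eq_of_mem_minimalOverAnnihilator _ _ h
      rwa [← e1, ← h2, comap_comap_mapDomainRingHom, huv, hid]
    · intro h
      rw [hv] at h
      obtain ⟨P', h1, h2⟩ := exists_mapDomain_comap_eq_of_mem_minimalOverAnnihilator _ _ h
      rwa [← e2, ← h2, comap_comap_mapDomainRingHom, hvu, hid]
  have hb := hC.bijOn X' hX'fin
  ext c
  constructor
  · rintro ⟨P, hP, Q, hQ, rfl⟩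
    refine ⟨Q, (hmin _).2 ?_, rfl⟩
    have hQ' : Q.asIdeal.comap (MonoidAlgebra.mapDomainRingHom k ι) = P.asIdeal :=
      congrArg PrimeSpectrum.asIdeal hQ
    rw [hQ']
    exact hb.mapsTo ((mem_minimalSupport_iff hfin).1 hP)
  · rintro ⟨Q, hQ, rfl⟩
    -- `Q ∩ kC` itself need not be minimal. It is replaced by a minimal prime `P` with the same
    -- contraction to `kX'`, and a prime `Q'` of `kA` over `P` has the same class as `Q` because the
    -- two agree on `kX`.
    obtain ⟨P, hP, hPQ⟩ := hb.surjOn ((hmin _).1 hQ)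
    obtain ⟨Q', hQ'⟩ := exists_comap_mapDomainRingHom_eq hιinj hιdense ⟨P, hP.1.1⟩
    refine ⟨⟨P, hP.1.1⟩, (mem_minimalSupport_iff hfin).2 hP, Q', hQ', ?_⟩
    refine primeClass_eq_of_primesEquivalent ⟨X, hXfg, hX, ?_⟩
    have hQ'' : Q'.asIdeal.comap (MonoidAlgebra.mapDomainRingHom k ι) = P :=
      congrArg PrimeSpectrum.asIdeal hQ'
    have e : X.subtype = ι.comp (X'.subtype.comp u) := rfl
    rw [e, ← comap_comap_mapDomainRingHom, ← comap_comap_mapDomainRingHom, ← hPQ, ← hQ'',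
      comap_comap_mapDomainRingHom, comap_comap_mapDomainRingHom]

/-- There are finitely many minimal primes, and each contributes at most one class: two primes of
`kA` over the same prime of `kC` agree on the group ring of the image of `C`, which is finitely
generated and dense. -/
theorem IsStableSubgroup.finite_classesOver (hC : IsStableSubgroup σ C) (hΓ : IsDenseSubgroup Γ)
    (hfin : Module.Finite (MonoidAlgebra k C) (Representation.asModule (σ.comp C.subtype))) :
    (classesOver (Γ.subtype.comp C.subtype) (minimalSupport (σ.comp C.subtype))).Finite := by
  classical
  have hCfg : Group.FG C := (Group.fg_iff_subgroup_fg _).2 hC.fg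
  set ι : C →* A := Γ.subtype.comp C.subtype with hι
  have hmin : (minimalSupport (σ.comp C.subtype)).Finite := by
    refine Set.Finite.of_finite_image (f := PrimeSpectrum.asIdeal)
      ((finite_minimalOverAnnihilator (σ.comp C.subtype)).subset ?_)
      fun P _ Q _ h => PrimeSpectrum.ext h
    rintro _ ⟨P, hP, rfl⟩
    exact (mem_minimalSupport_iff hfin).1 hP
  have hdense : IsDenseSubgroup ι.range := fun g => by
    obtain ⟨m, hm, hg⟩ := hΓ g
    obtain ⟨n, hn, hg'⟩ := hC.dense ⟨g ^ m, hg⟩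
    exact ⟨m * n, Nat.mul_pos hm hn, ⟨_, hg'⟩, by simp [hι, pow_mul]⟩
  have hfg : ι.range.FG := (Group.fg_iff_subgroup_fg _).1 (Group.fg_range ι)
  refine Set.Finite.subset (hmin.biUnion (t := fun P => {c | ∃ Q, PrimeSpectrum.comap
    (MonoidAlgebra.mapDomainRingHom k ι) Q = P ∧ c = primeClass Q}) fun P _ => ?_) ?_
  · refine Set.Subsingleton.finite ?_
    rintro _ ⟨Q, hQ, rfl⟩ _ ⟨Q', hQ', rfl⟩
    refine primeClass_eq_of_primesEquivalent ⟨ι.range, hfg, hdense, ?_⟩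
    have h1 : Q.asIdeal.comap (MonoidAlgebra.mapDomainRingHom k ι) =
        Q'.asIdeal.comap (MonoidAlgebra.mapDomainRingHom k ι) :=
      congrArg PrimeSpectrum.asIdeal (hQ.trans hQ'.symm)
    have e : ι = ι.range.subtype.comp ι.rangeRestrict := rfl
    rw [e, ← comap_comap_mapDomainRingHom, ← comap_comap_mapDomainRingHom] at h1
    refine Ideal.comap_injective_of_surjective _ (fun y => ?_) h1
    induction y using MonoidAlgebra.induction_linear with
    | zero => exact ⟨0, map_zero _⟩
    | add x y hx hy =>
      obtain ⟨x, rfl⟩ := hx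
      obtain ⟨y, rfl⟩ := hy
      exact ⟨x + y, map_add _ _ _⟩
    | single y c =>
      obtain ⟨x, rfl⟩ := ι.rangeRestrict_surjective y
      exact ⟨MonoidAlgebra.single x c, by simp⟩
  · rintro c ⟨P, hP, Q, hQ, rfl⟩
    exact Set.mem_biUnion hP ⟨Q, hQ, rfl⟩

end Stable

/-! ### Admissible subgroups -/

section Admissible

variable {N : Type*} [Group N] {K : Subgroup N} [K.Normal]

theorem IsAdmissible.map_fg {L : Subgroup N} (hL : IsAdmissible K L) :
    (L.map (QuotientGroup.mk' K)).FG := by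
  have := hL.fg
  rw [← Group.fg_iff_subgroup_fg]
  refine Group.fg_of_surjective (f := QuotientGroup.lift (K.subgroupOf L)
    ((QuotientGroup.mk' K).subgroupMap L) fun x hx => ?_) fun y => ?_
  · exact Subtype.ext ((QuotientGroup.eq_one_iff (x : N)).2 hx)
  · obtain ⟨x, rfl⟩ := (QuotientGroup.mk' K).subgroupMap_surjective L y
    exact ⟨(x : ↥L ⧸ K.subgroupOf L), rfl⟩

theorem IsAdmissible.of_map_fg {L : Subgroup N} (h₁ : IsDenseSubgroup L) (h₂ : K ≤ L)
    (h₃ : (L.map (QuotientGroup.mk' K)).FG) : IsAdmissible K L := by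
  refine ⟨h₁, h₂, ?_⟩
  have := (Group.fg_iff_subgroup_fg _).2 h₃
  have hker : ((QuotientGroup.mk' K).subgroupMap L).ker = K.subgroupOf L := by
    ext x
    rw [MonoidHom.mem_ker, Subgroup.mem_subgroupOf, ← QuotientGroup.eq_one_iff (x : N)]
    exact Subtype.ext_iff
  let e := (QuotientGroup.quotientKerEquivOfSurjective _
    ((QuotientGroup.mk' K).subgroupMap_surjective L)).symm.trans
      (QuotientGroup.quotientMulEquivOfEq hker)
  exact Group.fg_of_surjective (f := e.toMonoidHom) e.surjective

/-- This allows any given element of `kN` to be placed in the group ring of an admissible subgroup.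
-/
theorem IsAdmissible.exists_le_of_finset {L : Subgroup N} (h : IsAdmissible K L) (T : Finset N) :
    ∃ L' : Subgroup N, IsAdmissible K L' ∧ L ≤ L' ∧ (T : Set N) ⊆ L' := by
  classical
  set M := L.map (QuotientGroup.mk' K) ⊔
    Subgroup.closure ((T.image (QuotientGroup.mk' K) : Finset (N ⧸ K)) : Set (N ⧸ K))
  have hM : M.FG := h.map_fg.sup ⟨_, rfl⟩
  have hle : L ≤ M.comap (QuotientGroup.mk' K) := Subgroup.map_le_iff_le_comap.1 le_sup_left
  refine ⟨M.comap (QuotientGroup.mk' K), .of_map_fg (h.dense.mono hle) (h.le.trans hle) ?_, hle, ?_⟩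
  · rwa [Subgroup.map_comap_eq_self_of_surjective (QuotientGroup.mk'_surjective K)]
  · intro t ht
    exact le_sup_right (a := L.map (QuotientGroup.mk' K))
      (Subgroup.subset_closure (Finset.mem_coe.2 (Finset.mem_image_of_mem _ ht)))

variable [IsMulCommutative (N ⧸ K)]

theorem IsAdmissible.inf {L L' : Subgroup N} (h : IsAdmissible K L) (h' : IsAdmissible K L') :
    IsAdmissible K (L ⊓ L') :=
  .of_map_fg (h.dense.inf h'.dense) (le_inf h.le h'.le)
    (h.map_fg.of_le_of_comm (Subgroup.map_mono inf_le_left))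

theorem IsAdmissible.exists_finset_transversal {L L' : Subgroup N} (h : IsAdmissible K L)
    (h' : IsAdmissible K L') :
    ∃ T : Finset N, (T : Set N) ⊆ L' ∧ ∀ l ∈ L', ∃ t ∈ T, l * t⁻¹ ∈ L := by
  classical
  obtain ⟨T, hT, hTL⟩ := _root_.exists_finset_transversal (H := L.map (QuotientGroup.mk' K))
    h'.map_fg (by
      rintro _ ⟨l, -, rfl⟩
      obtain ⟨n, hn, hl⟩ := h.dense l
      exact ⟨n, hn, l ^ n, hl, rfl⟩)
  have hs : ∀ t : T, ∃ l ∈ L', (l : N ⧸ K) = t := fun t => hT t.2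
  choose s hs hst using hs
  refine ⟨Finset.univ.image s, ?_, fun l hl => ?_⟩
  · intro t ht
    obtain ⟨q, -, rfl⟩ := Finset.mem_image.1 (Finset.mem_coe.1 ht)
    exact hs q
  · obtain ⟨t, ht, g, hg, hgl⟩ := hTL l ⟨l, hl, rfl⟩
    refine ⟨s ⟨t, ht⟩, Finset.mem_image_of_mem _ (Finset.mem_univ _), ?_⟩
    have h1 : ((g⁻¹ * (l * (s ⟨t, ht⟩)⁻¹) : N) : N ⧸ K) = 1 := by
      rw [QuotientGroup.mk_mul, QuotientGroup.mk_mul, QuotientGroup.mk_inv, QuotientGroup.mk_inv,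
        hst, inv_mul_eq_one]
      exact hgl
    have := L.mul_mem hg (h.le ((QuotientGroup.eq_one_iff _).1 h1))
    rwa [mul_inv_cancel_left] at this

theorem IsQuasicyclic.exists_pow_eq_one {G : Type*} [Group G] (h : IsQuasicyclic G) (g : G) :
    ∃ n : ℕ, 0 < n ∧ g ^ n = 1 := by
  obtain ⟨p, hp, ⟨e⟩⟩ := h
  obtain ⟨n, hn⟩ := (e g).2
  refine ⟨p ^ n, pow_pos hp.out.pos n, e.injective (Subtype.ext ?_)⟩
  rw [map_pow, map_one, Subgroup.coe_pow, hn]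
  rfl

/-- Ascend the series: a cyclic factor contributes the image of a generator, while a quasi-cyclic
factor is torsion and needs no new generator (`y = 1`). -/
theorem IsMinimaxGroup.exists_finset_dense {G B : Type*} [Group G] [CommGroup B]
    (hG : IsMinimaxGroup G) (f : G →* B) :
    ∃ S : Finset B, ∀ x, ∃ m : ℕ, 0 < m ∧ f x ^ m ∈ Subgroup.closure (S : Set B) := by
  classical
  obtain ⟨n, H, hH0, hHn, hH⟩ := hG
  have key : ∀ i ≤ n, ∃ S : Finset B, ∀ x ∈ H i, ∃ m : ℕ, 0 < m ∧
      f x ^ m ∈ Subgroup.closure (S : Set B) := by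
    intro i
    induction i with
    | zero =>
      intro _
      refine ⟨∅, fun x hx => ⟨1, one_pos, ?_⟩⟩
      rw [hH0, Subgroup.mem_bot] at hx
      rw [hx, map_one, one_pow]
      exact one_mem _
    | succ i ih =>
      intro hi
      obtain ⟨S, hS⟩ := ih (by omega)
      obtain ⟨-, hnorm, hfac⟩ := hH i (by omega)
      have hy : ∃ y : G, ∀ x ∈ H (i + 1), ∃ m : ℕ, 0 < m ∧ ∃ j : ℤ,
          x ^ m * (y ^ j)⁻¹ ∈ H i := by
        rcases hfac with hcyc | hqc
        · obtain ⟨q, hq⟩ := hcyc.exists_generator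
          obtain ⟨y, rfl⟩ := QuotientGroup.mk_surjective q
          refine ⟨y, fun x hx => ⟨1, one_pos, ?_⟩⟩
          obtain ⟨j, hj⟩ := hq ((⟨x, hx⟩ : H (i + 1)) : ↥(H (i + 1)) ⧸ (H i).subgroupOf (H (i + 1)))
          refine ⟨j, ?_⟩
          have h1 : (((⟨x, hx⟩ : H (i + 1)) * (y ^ j)⁻¹ : H (i + 1)) :
              ↥(H (i + 1)) ⧸ (H i).subgroupOf (H (i + 1))) = 1 := by
            rw [QuotientGroup.mk_mul, QuotientGroup.mk_inv, QuotientGroup.mk_zpow,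
              mul_inv_eq_one]
            exact hj.symm
          have h2 := Subgroup.mem_subgroupOf.1 ((QuotientGroup.eq_one_iff _).1 h1)
          simpa using h2
        · refine ⟨1, fun x hx => ?_⟩
          obtain ⟨m, hm, h1⟩ := hqc.exists_pow_eq_one
            ((⟨x, hx⟩ : H (i + 1)) : ↥(H (i + 1)) ⧸ (H i).subgroupOf (H (i + 1)))
          rw [← QuotientGroup.mk_pow, QuotientGroup.eq_one_iff, Subgroup.mem_subgroupOf] at h1
          exact ⟨m, hm, 0, by simpa using h1⟩
      obtain ⟨y, hy⟩ := hy
      refine ⟨insert (f y) S, fun x hx => ?_⟩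
      obtain ⟨m, hm, j, hxj⟩ := hy x hx
      obtain ⟨m', hm', h1⟩ := hS _ hxj
      refine ⟨m * m', Nat.mul_pos hm hm', ?_⟩
      have hle : Subgroup.closure (S : Set B) ≤
          Subgroup.closure ((insert (f y) S : Finset B) : Set B) :=
        Subgroup.closure_mono (by simp)
      have hfy : f y ∈ Subgroup.closure ((insert (f y) S : Finset B) : Set B) :=
        Subgroup.subset_closure (by simp)
      have e : f x ^ (m * m') = f (x ^ m * (y ^ j)⁻¹) ^ m' * (f y ^ j) ^ m' := by
        rw [← mul_pow, ← map_zpow, ← map_mul, inv_mul_cancel_right, map_pow, pow_mul]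
      rw [e]
      exact mul_mem (hle h1) (pow_mem (zpow_mem hfy j) m')
  obtain ⟨S, hS⟩ := key n le_rfl
  exact ⟨S, fun x => hS x (hHn ▸ Subgroup.mem_top x)⟩

theorem IsMinimaxGroup.exists_isAdmissible (hN : IsMinimaxGroup N) :
    ∃ L : Subgroup N, IsAdmissible K L := by
  obtain ⟨S, hS⟩ := hN.exists_finset_dense (QuotientGroup.mk' K)
  refine ⟨(Subgroup.closure (S : Set (N ⧸ K))).comap (QuotientGroup.mk' K),
    .of_map_fg (fun g => ?_) ?_ ?_⟩
  · obtain ⟨m, hm, h⟩ := hS g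
    exact ⟨m, hm, by rwa [Subgroup.mem_comap, map_pow]⟩
  · intro g hg
    rw [Subgroup.mem_comap, (show QuotientGroup.mk' K g = 1 from (QuotientGroup.eq_one_iff g).2 hg)]
    exact one_mem _
  · rw [Subgroup.map_comap_eq_self_of_surjective (QuotientGroup.mk'_surjective K)]
    exact ⟨S, rfl⟩

end Admissible

/-! ### The action of the central subgroup -/

section CentralAction

variable {N : Type*} [Group N] {k : Type*} [Field k] {W : Type*} [AddCommGroup W] [Module k W]
  [Module (MonoidAlgebra k N) W] [IsScalarTower k (MonoidAlgebra k N) W]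
  {K : Subgroup N} {I : InvariantIdeal k K} {A : Subgroup (N ⧸ I.dagger)}
  {L : Subgroup N} {a : W}

theorem isCentralModulo_of_reduction_eq (hA : A ≤ Subgroup.center (N ⧸ I.dagger)) {Y : Type*}
    [CommGroup Y] (g : Y →* A) {f : MonoidAlgebra k Y} {x : MonoidAlgebra k N}
    (hx : reduction k I.dagger x = MonoidAlgebra.mapDomainRingHom k (A.subtype.comp g) f) :
    IsCentralModulo I.dagger x := by
  intro r
  rw [map_mul, map_mul, hx]
  clear hx
  generalize reduction k I.dagger r = z
  induction f using MonoidAlgebra.induction_linear with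
  | zero => simp
  | add f f' hf hf' => rw [map_add, add_mul, mul_add, hf, hf']
  | single y c =>
    induction z using MonoidAlgebra.induction_linear with
    | zero => simp
    | add z z' hz hz' => rw [mul_add, add_mul, hz, hz']
    | single q d =>
      rw [MonoidAlgebra.mapDomainRingHom_apply, MonoidAlgebra.mapDomain_single,
        MonoidAlgebra.single_mul_single, MonoidAlgebra.single_mul_single, mul_comm c d]
      exact congrArg (fun z => MonoidAlgebra.single z (d * c))
        (Subgroup.mem_center_iff.1 (hA (g y).2) q).symm

/-- Translates the action of `kY` on the quotient `U / I U` into the action of elements of `kL` on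
`U`, where the Artin–Rees property is available. -/
theorem exists_lift_acting (L : Subgroup N) (a : W) {Y : Type*} [CommGroup Y]
    (j : Y →* centralPart I L A) (f : MonoidAlgebra k Y) :
    ∃ x ∈ groupSubalgebra k L, reduction k I.dagger x = MonoidAlgebra.mapDomainRingHom k
        (A.subtype.comp ((centralPart I L A).subtype.comp j)) f ∧
      ∀ u v : ↥(cyclicSub (k := k) L a), (v : W) = x • (u : W) →
        Representation.asAlgebraHom ((centralRep I L a A).comp j) f ((idealSub I L a).mkQ u) =
          (idealSub I L a).mkQ v := by
  induction f using MonoidAlgebra.induction_linear with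
  | zero =>
    refine ⟨0, zero_mem _, by simp, fun u v h => ?_⟩
    rw [zero_smul] at h
    rw [show v = 0 from Subtype.ext h, map_zero, map_zero, LinearMap.zero_apply]
  | add f f' hf hf' =>
    obtain ⟨x, hx, hxf, hxu⟩ := hf
    obtain ⟨x', hx', hxf', hxu'⟩ := hf'
    refine ⟨x + x', add_mem hx hx', by rw [map_add, map_add, hxf, hxf'], fun u v h => ?_⟩
    rw [add_smul] at h
    have hv : v = ⟨x • (u : W), smul_mem_generatedSub hx u.2⟩ +
        ⟨x' • (u : W), smul_mem_generatedSub hx' u.2⟩ := Subtype.ext h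
    rw [hv, map_add, map_add, LinearMap.add_apply, hxu u ⟨x • (u : W), smul_mem_generatedSub hx u.2⟩ rfl,
      hxu' u ⟨x' • (u : W), smul_mem_generatedSub hx' u.2⟩ rfl]
  | single y c =>
    obtain ⟨l, hl, hly⟩ := (j y).2
    refine ⟨MonoidAlgebra.single l c, single_mem_groupSubalgebra hl c, ?_, fun u v h => ?_⟩
    · rw [reduction_single, MonoidAlgebra.mapDomainRingHom_apply, MonoidAlgebra.mapDomain_single]
      exact congrArg (fun q => MonoidAlgebra.single q c) hly
    · have e : centralPartInclusion I L A (j y) = imageProj I L ⟨l, hl⟩ := Subtype.ext hly.symm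
      rw [Representation.asAlgebraHom_single, LinearMap.smul_apply]
      have e' : ((centralRep I L a A).comp j) y = imageRep I L a (imageProj I L ⟨l, hl⟩) := by
        rw [← e]; rfl
      rw [e', imageRep_apply, ← map_smul]
      congr 1
      refine Subtype.ext ?_
      rw [h, Submodule.coe_smul, cyclicRep_apply, ← smul_assoc]
      congr 1
      simp [MonoidAlgebra.of_apply]

theorem mkQ_idealSub_eq_zero_iff {u : ↥(cyclicSub (k := k) L a)} :
    (idealSub I L a).mkQ u = 0 ↔ (u : W) ∈ I.carrier • generatedSub k L {a} := by
  rw [Submodule.mkQ_apply, Submodule.Quotient.mk_eq_zero]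
  rfl

/-- Since `A` is central, `x` is central modulo `I†`, so it is enough to test the generator `a`. -/
theorem mem_annihilator_centralRep_iff (hA : A ≤ Subgroup.center (N ⧸ I.dagger)) {Y : Type*}
    [CommGroup Y] (j : Y →* centralPart I L A) {f : MonoidAlgebra k Y} {x : MonoidAlgebra k N}
    (hx : x ∈ groupSubalgebra k L) (hxf : reduction k I.dagger x =
      MonoidAlgebra.mapDomainRingHom k (A.subtype.comp ((centralPart I L A).subtype.comp j)) f) :
    f ∈ Module.annihilator (MonoidAlgebra k Y)
        (Representation.asModule ((centralRep I L a A).comp j)) ↔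
      x • a ∈ I.carrier • generatedSub k L {a} := by
  have hxc := isCentralModulo_of_reduction_eq hA _ hxf
  obtain ⟨x₀, hx₀, hxf₀, hact⟩ := exists_lift_acting L a j f
  have hred : reduction k I.dagger (x - x₀) = 0 := by rw [map_sub, hxf, hxf₀, sub_self]
  have hkey : ∀ u : ↥(cyclicSub (k := k) L a),
      Representation.asAlgebraHom ((centralRep I L a A).comp j) f ((idealSub I L a).mkQ u) = 0 ↔
        x • (u : W) ∈ I.carrier • generatedSub k L {a} := by
    intro u
    rw [hact u ⟨x₀ • (u : W), smul_mem_generatedSub hx₀ u.2⟩ rfl, mkQ_idealSub_eq_zero_iff]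
    have h1 := smul_mem_ideal_smul_of_reduction_eq_zero (sub_mem hx hx₀) hred
      (u := (u : W)) (S := {a}) u.2
    have h2 : x • (u : W) = (x - x₀) • (u : W) + x₀ • (u : W) := by rw [sub_smul, sub_add_cancel]
    rw [h2]
    exact (Submodule.add_mem_iff_right _ h1).symm
  rw [mem_annihilator_asModule]
  constructor
  · intro h
    exact (hkey ⟨a, subset_generatedSub rfl⟩).1 (h _)
  · intro h m
    obtain ⟨u, rfl⟩ := (idealSub I L a).mkQ_surjective m
    exact (hkey u).2 (smul_mem_ideal_smul_of_isCentralModulo hx hxc (by simpa using h) u.2)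

theorem mem_generatedSub_singleton {u : W} :
    u ∈ generatedSub k L {a} ↔ ∃ r ∈ groupSubalgebra k L, r • a = u := by
  constructor
  · intro h
    refine Submodule.smul_induction_on h (fun r hr w hw => ?_) ?_
    · obtain ⟨c, rfl⟩ := Submodule.mem_span_singleton.1 hw
      exact ⟨c • r, Subalgebra.smul_mem _ hr c, by rw [smul_assoc, smul_comm]⟩
    · rintro _ _ ⟨r, hr, rfl⟩ ⟨s, hs, rfl⟩
      exact ⟨r + s, add_mem hr hs, add_smul _ _ _⟩
  · rintro ⟨r, hr, rfl⟩
    exact smul_mem_generatedSub hr (subset_generatedSub rfl)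

/-- If finitely many translates of `Y` cover `L`, then the quotient of a cyclic `kL`-module is a
finitely generated `kY`-module. -/
theorem finite_asModule_centralRep {Y : Type*} [CommGroup Y] (j : Y →* centralPart I L A)
    {T : Finset N} (hTL : (T : Set N) ⊆ L)
    (hT : ∀ l ∈ L, ∃ t ∈ T, ∃ y : Y, (l : N ⧸ I.dagger) = ((j y : A) : N ⧸ I.dagger) * t) :
    Module.Finite (MonoidAlgebra k Y) (Representation.asModule ((centralRep I L a A).comp j)) := by
  classical
  set σ : Representation k Y (CyclicQuotient I L a) := (centralRep I L a A).comp j with hσ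
  let w : T → ↥(cyclicSub (k := k) L a) := fun t =>
    ⟨MonoidAlgebra.of k N (t : N) • a,
      smul_mem_generatedSub (of_mem_groupSubalgebra (hTL t.2)) (subset_generatedSub rfl)⟩
  let m : T → σ.asModule := fun t => σ.asModuleEquiv.symm ((idealSub I L a).mkQ (w t))
  have hspan : ∀ r ∈ groupSubalgebra k L, ∀ v : ↥(cyclicSub (k := k) L a), (v : W) = r • a →
      σ.asModuleEquiv.symm ((idealSub I L a).mkQ v) ∈
        Submodule.span (MonoidAlgebra k Y) (Set.range m) := by
    intro r hr
    refine (groupSubalgebra_induction (H := L) (p := fun r => r ∈ groupSubalgebra k L ∧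
      ∀ v : ↥(cyclicSub (k := k) L a), (v : W) = r • a →
      σ.asModuleEquiv.symm ((idealSub I L a).mkQ v) ∈
        Submodule.span (MonoidAlgebra k Y) (Set.range m)) ?_ ?_ ?_ hr).2
    · refine ⟨zero_mem _, fun v hv => ?_⟩
      rw [zero_smul] at hv
      rw [show v = 0 from Subtype.ext hv, map_zero, map_zero]
      exact zero_mem _
    · rintro x y ⟨hxL, hx⟩ ⟨hyL, hy⟩
      refine ⟨add_mem hxL hyL, fun v hv => ?_⟩
      have e : v = ⟨x • a, smul_mem_generatedSub hxL (subset_generatedSub rfl)⟩ +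
          ⟨y • a, smul_mem_generatedSub hyL (subset_generatedSub rfl)⟩ :=
        Subtype.ext (by rw [hv, add_smul]; rfl)
      rw [e, map_add, map_add]
      exact add_mem (hx _ rfl) (hy _ rfl)
    · intro l hl c
      refine ⟨single_mem_groupSubalgebra hl c, fun v hv => ?_⟩
      obtain ⟨t, ht, y, hlt⟩ := hT l hl
      obtain ⟨x, hx, hxf, hact⟩ := exists_lift_acting L a j (MonoidAlgebra.single y c)
      have hxw : x • (w ⟨t, ht⟩ : W) ∈ cyclicSub (k := k) L a :=
        smul_mem_generatedSub hx (w ⟨t, ht⟩).2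
      have e1 : σ.asModuleEquiv (MonoidAlgebra.single y c • m ⟨t, ht⟩) =
          (idealSub I L a).mkQ ⟨x • (w ⟨t, ht⟩ : W), hxw⟩ := by
        rw [Representation.asModuleEquiv_map_smul, LinearEquiv.apply_symm_apply]
        exact hact _ _ rfl
      have e2 : (idealSub I L a).mkQ v = (idealSub I L a).mkQ ⟨x • (w ⟨t, ht⟩ : W), hxw⟩ := by
        rw [← sub_eq_zero, ← map_sub, mkQ_idealSub_eq_zero_iff]
        have e3 : ((v - ⟨x • (w ⟨t, ht⟩ : W), hxw⟩ : ↥(cyclicSub (k := k) L a)) : W) =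
            (MonoidAlgebra.single l c - x * MonoidAlgebra.of k N t) • a := by
          rw [sub_smul, mul_smul, Submodule.coe_sub, hv]
        rw [e3]
        refine smul_mem_ideal_smul_of_reduction_eq_zero (sub_mem (single_mem_groupSubalgebra hl c)
          (mul_mem hx (of_mem_groupSubalgebra (hTL ht)))) ?_ (subset_generatedSub rfl)
        rw [map_sub, map_mul, hxf, reduction_single, MonoidAlgebra.of_apply, reduction_single,
          MonoidAlgebra.mapDomainRingHom_apply, MonoidAlgebra.mapDomain_single,
          MonoidAlgebra.single_mul_single, mul_one, sub_eq_zero]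
        exact congrArg (fun q => MonoidAlgebra.single q c) hlt
      rw [e2, ← e1, LinearEquiv.symm_apply_apply]
      exact Submodule.smul_mem _ _ (Submodule.subset_span ⟨_, rfl⟩)
  -- The generators are the classes of the translates `t a` with `t ∈ T`.
  refine ⟨⟨Finset.univ.image m, eq_top_iff.2 fun z _ => ?_⟩⟩
  rw [Finset.coe_image, Finset.coe_univ, Set.image_univ]
  obtain ⟨u, hu⟩ := (idealSub I L a).mkQ_surjective (σ.asModuleEquiv z)
  obtain ⟨r, hr, hru⟩ := mem_generatedSub_singleton.1 u.2
  have := hspan r hr u hru.symm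
  rwa [hu, LinearEquiv.symm_apply_apply] at this

end CentralAction

/-! ### The central subgroup and its finitely generated dense subgroups -/

section CentralPart

variable {N : Type*} [Group N] {k : Type*} [Field k] {K : Subgroup N} {I : InvariantIdeal k K}
  {A : Subgroup (N ⧸ I.dagger)} {L L' : Subgroup N}

theorem centralPart_mono (h : L ≤ L') : centralPart I L A ≤ centralPart I L' A :=
  Subgroup.comap_mono (Subgroup.map_mono h)

/-- Two lifts of the same element differ by `I† ≤ K ≤ L'`, so a lift to `L` automatically lies in
`L'`. -/
theorem le_centralPart_inf (hL' : K ≤ L') {X : Subgroup A} (h : X ≤ centralPart I L A)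
    (h' : X ≤ centralPart I L' A) : X ≤ centralPart I (L ⊓ L') A := fun x hx => by
  obtain ⟨l, hl, hlx⟩ := h hx
  obtain ⟨l', hl', hlx'⟩ := h' hx
  refine ⟨l, ⟨hl, ?_⟩, hlx⟩
  have h1 : l'⁻¹ * l ∈ I.dagger := QuotientGroup.eq.1 (hlx'.trans hlx.symm)
  have := L'.mul_mem hl' (hL' (I.dagger_le h1))
  rwa [mul_inv_cancel_left] at this

theorem isDenseSubgroup_centralPart (hL : IsDenseSubgroup L) :
    IsDenseSubgroup (centralPart I L A) := fun x => by
  obtain ⟨g, hg⟩ := QuotientGroup.mk_surjective (x : N ⧸ I.dagger)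
  obtain ⟨n, hn, h⟩ := hL g
  exact ⟨n, hn, g ^ n, h, by rw [map_pow, map_pow, Subgroup.coe_subtype, ← hg]; rfl⟩

variable [K.Normal]

/-- The projection of `N / I†` onto `N / K`. -/
def daggerProj (I : InvariantIdeal k K) : N ⧸ I.dagger →* N ⧸ K :=
  QuotientGroup.map I.dagger K (MonoidHom.id N) I.dagger_le

theorem daggerProj_mk (g : N) : daggerProj I (g : N ⧸ I.dagger) = (g : N ⧸ K) := rfl

/-- The kernel lies in the finite group `K / I†`, hence is trivial in the torsion-free group `A`. So
`A` embeds in `N / K`, which makes `A ∩ L / I†` finitely generated for admissible `L`. -/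
theorem daggerProj_comp_subtype_injective (hI : Finite (↥K ⧸ I.dagger.subgroupOf K))
    (hA : GroupIsTorsionFree A) : Function.Injective ((daggerProj I).comp A.subtype) := by
  refine (injective_iff_map_eq_one _).2 fun x hx => hA x ?_
  obtain ⟨g, hg⟩ := QuotientGroup.mk_surjective (x : N ⧸ I.dagger)
  have hgK : g ∈ K := by
    rw [MonoidHom.comp_apply, Subgroup.coe_subtype, ← hg, daggerProj_mk] at hx
    exact (QuotientGroup.eq_one_iff g).1 hx
  obtain ⟨n, hn, h⟩ := isOfFinOrder_iff_pow_eq_one.1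
    (isOfFinOrder_of_finite ((⟨g, hgK⟩ : K) : ↥K ⧸ I.dagger.subgroupOf K))
  rw [← QuotientGroup.mk_pow, QuotientGroup.eq_one_iff, Subgroup.mem_subgroupOf] at h
  refine isOfFinOrder_iff_pow_eq_one.2 ⟨n, hn, Subtype.ext ?_⟩
  rw [Subgroup.coe_pow, ← hg, ← QuotientGroup.mk_pow]
  exact (QuotientGroup.eq_one_iff _).2 h

theorem daggerProj_mem_of_mem_imageSubgroup {x : N ⧸ I.dagger} (hx : x ∈ imageSubgroup I L) :
    daggerProj I x ∈ L.map (QuotientGroup.mk' K) := by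
  obtain ⟨l, hl, rfl⟩ := hx
  exact ⟨l, hl, rfl⟩

variable [IsMulCommutative (N ⧸ K)]

theorem IsAdmissible.fg_centralPart (hL : IsAdmissible K L)
    (hI : Finite (↥K ⧸ I.dagger.subgroupOf K)) (hA : GroupIsTorsionFree A) :
    (centralPart I L A).FG := by
  refine .of_map_injective (daggerProj_comp_subtype_injective hI hA)
    (hL.map_fg.of_le_of_comm ?_)
  rintro _ ⟨x, hx, rfl⟩
  exact daggerProj_mem_of_mem_imageSubgroup hx

/-- The translates are products of representatives of `K / I†` with representatives of the image of
`L` in `N / K` modulo that of `C`; both sets are finite. -/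
theorem IsAdmissible.exists_finset_translates (hL : IsAdmissible K L)
    (hI : Finite (↥K ⧸ I.dagger.subgroupOf K)) (hA : A.FiniteIndex)
    {C : Subgroup (centralPart I L A)} (hC : IsDenseSubgroup C) :
    ∃ T : Finset N, (T : Set N) ⊆ L ∧ ∀ l ∈ L, ∃ t ∈ T, ∃ y : C,
      (l : N ⧸ I.dagger) = ((y : A) : N ⧸ I.dagger) * t := by
  classical
  set ι : C →* N ⧸ I.dagger := A.subtype.comp ((centralPart I L A).subtype.comp C.subtype)
  obtain ⟨T, hT, hTL⟩ := _root_.exists_finset_transversal (H := ((daggerProj I).comp ι).range)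
    hL.map_fg (by
      rintro _ ⟨l, hl, rfl⟩
      obtain ⟨n, hn, h⟩ := IsDenseSubgroup.of_finiteIndex hA (l : N ⧸ I.dagger)
      have hmem : (⟨(l : N ⧸ I.dagger) ^ n, h⟩ : A) ∈ centralPart I L A := ⟨l ^ n, pow_mem hl n, rfl⟩
      obtain ⟨m, hm, h'⟩ := hC ⟨_, hmem⟩
      exact ⟨n * m, Nat.mul_pos hn hm, ⟨_, h'⟩, by rw [pow_mul]; rfl⟩)
  have hs : ∀ t : T, ∃ l ∈ L, (l : N ⧸ K) = t := fun t => hT t.2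
  choose s hs hst using hs
  have := Fintype.ofFinite (↥K ⧸ I.dagger.subgroupOf K)
  let F : Finset N := Finset.univ.image fun q : ↥K ⧸ I.dagger.subgroupOf K => (q.out : N)
  refine ⟨(F ×ˢ Finset.univ).image fun p => p.1 * s p.2, ?_, fun l hl => ?_⟩
  · intro t ht
    obtain ⟨⟨f, q⟩, hp, rfl⟩ := Finset.mem_image.1 (Finset.mem_coe.1 ht)
    obtain ⟨c, -, rfl⟩ := Finset.mem_image.1 (Finset.mem_product.1 hp).1
    exact mul_mem (hL.le c.out.2) (hs q)
  · obtain ⟨t, ht, c, hc⟩ := hTL l ⟨l, hl, rfl⟩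
    obtain ⟨g, hg⟩ := QuotientGroup.mk_surjective
      ((ι c)⁻¹ * (l : N ⧸ I.dagger) * ((s ⟨t, ht⟩ : N) : N ⧸ I.dagger)⁻¹)
    have hgK : g ∈ K := by
      rw [← QuotientGroup.eq_one_iff, ← daggerProj_mk (I := I), hg, map_mul, map_mul, map_inv,
        map_inv, daggerProj_mk, daggerProj_mk, hst, mul_assoc, inv_mul_eq_one]
      exact hc
    set f : K := ((⟨g, hgK⟩ : K) : ↥K ⧸ I.dagger.subgroupOf K).out with hf
    have hfg : ((f : N) : N ⧸ I.dagger) = g := by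
      have h1 : (f : ↥K ⧸ I.dagger.subgroupOf K) = (⟨g, hgK⟩ : K) := Quotient.out_eq' _
      exact QuotientGroup.eq.2 (Subgroup.mem_subgroupOf.1 (QuotientGroup.eq.1 h1))
    refine ⟨f * s ⟨t, ht⟩, Finset.mem_image.2 ⟨(f, ⟨t, ht⟩), Finset.mem_product.2
      ⟨Finset.mem_image_of_mem _ (Finset.mem_univ _), Finset.mem_univ _⟩, rfl⟩, c, ?_⟩
    rw [QuotientGroup.mk_mul, hfg, hg]
    change _ = ι c * _
    group

theorem IsAdmissible.finite_asModule [IsMulCommutative A] (hL : IsAdmissible K L)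
    (hI : Finite (↥K ⧸ I.dagger.subgroupOf K)) (hA : A.FiniteIndex)
    {W : Type*} [AddCommGroup W] [Module k W] [Module (MonoidAlgebra k N) W]
    [IsScalarTower k (MonoidAlgebra k N) W] (a : W)
    {C : Subgroup (centralPart I L A)} (hC : IsDenseSubgroup C) :
    Module.Finite (MonoidAlgebra k C)
      (Representation.asModule ((centralRep I L a A).comp C.subtype)) := by
  obtain ⟨T, hTL, hT⟩ := hL.exists_finset_translates hI hA hC
  exact finite_asModule_centralRep C.subtype hTL hT

end CentralPart

/-! ### Comparison of radicals of annihilators -/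

section Radical

variable {N : Type*} [Group N] {k : Type*} [Field k] {W : Type*} [AddCommGroup W] [Module k W]
  [Module (MonoidAlgebra k N) W] [IsScalarTower k (MonoidAlgebra k N) W]
  {K : Subgroup N} {I : InvariantIdeal k K} {A : Subgroup (N ⧸ I.dagger)} [IsMulCommutative A]
  {L L' : Subgroup N} {X : Subgroup A}

/-- The radical of the annihilator in `kX` of `U / I U`, where `U` is the `kL`-submodule generated
by `a` and `X ≤ A ∩ L / I†`. -/
noncomputable def annihilatorRadical (I : InvariantIdeal k K) {A : Subgroup (N ⧸ I.dagger)}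
    [IsMulCommutative A] {L : Subgroup N} (a : W) {X : Subgroup A}
    (hX : X ≤ centralPart I L A) : Ideal (MonoidAlgebra k X) :=
  (Module.annihilator (MonoidAlgebra k X) (Representation.asModule
    ((centralRep I L a A).comp (Subgroup.inclusion hX)))).radical

/-- An ideal and its radical have the same minimal primes, so only the radical has to be controlled.
-/
theorem minimalOverAnnihilator_eq (a : W) (hX : X ≤ centralPart I L A) :
    minimalOverAnnihilator ((centralRep I L a A).comp (Subgroup.inclusion hX)) =
      (annihilatorRadical I a hX).minimalPrimes :=
  Ideal.radical_minimalPrimes.symm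

theorem annihilatorRadical_comap (a : W) (hX : X ≤ centralPart I L A) {Y : Subgroup A}
    (hY : Y ≤ X) : (annihilatorRadical I a hX).comap
      (MonoidAlgebra.mapDomainRingHom k (Subgroup.inclusion hY)) =
        annihilatorRadical I a (hY.trans hX) := by
  rw [annihilatorRadical, Ideal.comap_radical, ← annihilator_comp]
  rfl

theorem mem_annihilatorRadical_iff (hA : A ≤ Subgroup.center (N ⧸ I.dagger)) {a : W}
    (hX : X ≤ centralPart I L A) {f : MonoidAlgebra k X} {x : MonoidAlgebra k N}
    (hx : x ∈ groupSubalgebra k L) (hxf : reduction k I.dagger x =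
      MonoidAlgebra.mapDomainRingHom k (A.subtype.comp X.subtype) f) :
    f ∈ annihilatorRadical I a hX ↔ ∃ m : ℕ, x ^ m • a ∈ I.carrier • generatedSub k L {a} :=
  exists_congr fun m => mem_annihilator_centralRep_iff hA (Subgroup.inclusion hX) (pow_mem hx m)
    (by rw [map_pow, map_pow, hxf]; rfl)

theorem exists_lift_of_le_centralPart (hX : X ≤ centralPart I L A) (f : MonoidAlgebra k X) :
    ∃ x ∈ groupSubalgebra k L, reduction k I.dagger x =
      MonoidAlgebra.mapDomainRingHom k (A.subtype.comp X.subtype) f := by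
  obtain ⟨x, hx, hxf, -⟩ := exists_lift_acting (W := MonoidAlgebra k N) L 0
    (Subgroup.inclusion hX) f
  exact ⟨x, hx, hxf⟩

theorem annihilatorRadical_le_of_le (hA : A ≤ Subgroup.center (N ⧸ I.dagger)) (hL : L ≤ L')
    (a : W) (hX : X ≤ centralPart I L A) (hX' : X ≤ centralPart I L' A) :
    annihilatorRadical I a hX ≤ annihilatorRadical I a hX' := fun f hf => by
  obtain ⟨x, hx, hxf⟩ := exists_lift_of_le_centralPart hX f
  obtain ⟨m, hm⟩ := (mem_annihilatorRadical_iff hA hX hx hxf).1 hf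
  refine (mem_annihilatorRadical_iff hA hX' (groupSubalgebra_mono hL hx) hxf).2 ⟨m, ?_⟩
  exact Submodule.smul_mono le_rfl (generatedSub_le hL fun s hs => subset_generatedSub hs) hm

variable [K.Normal] [IsMulCommutative (N ⧸ K)] [Group.IsNilpotent N] [CharZero k]

/-- Here Artin–Rees is used. Finitely many cosets of `L` cover `L'`, so `kL'a` is a finitely
generated `kL`-module containing `b`, and a power of `x` maps it into `I` times itself. -/
theorem annihilatorRadical_le_of_mem (hA : A ≤ Subgroup.center (N ⧸ I.dagger))
    (hI : Finite (↥K ⧸ I.dagger.subgroupOf K)) (h : IsAdmissible K L) (h' : IsAdmissible K L')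
    (hL : L ≤ L') {a b : W} (hb : b ∈ generatedSub k L' {a}) (hX : X ≤ centralPart I L A)
    (hX' : X ≤ centralPart I L' A) :
    annihilatorRadical I a hX' ≤ annihilatorRadical I b hX := fun f hf => by
  classical
  obtain ⟨x, hx, hxf⟩ := exists_lift_of_le_centralPart hX f
  have hx' := groupSubalgebra_mono hL hx
  obtain ⟨m, hm⟩ := (mem_annihilatorRadical_iff hA hX' hx' hxf).1 hf
  have hxc := (isCentralModulo_of_reduction_eq hA X.subtype hxf).pow m
  -- The translates of `a` by the representatives `T` generate `kL'a` over `kL`.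
  obtain ⟨T, hTL, hT⟩ := h.exists_finset_transversal h'
  set S : Finset W := T.image fun t => MonoidAlgebra.of k N t • a
  have hS : generatedSub k L' {a} ≤ generatedSub k L (S : Set W) := fun u hu => by
    obtain ⟨r, hr, rfl⟩ := mem_generatedSub_singleton.1 hu
    refine groupSubalgebra_induction (H := L')
      (p := fun r => r • a ∈ generatedSub k L (S : Set W)) (by simp)
      (fun x y hx hy => by rw [add_smul]; exact add_mem hx hy) (fun l hl c => ?_) hr
    obtain ⟨t, ht, hlt⟩ := hT l hl
    have e : (MonoidAlgebra.single l c : MonoidAlgebra k N) =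
        MonoidAlgebra.single (l * t⁻¹) c * MonoidAlgebra.of k N t := by
      rw [MonoidAlgebra.of_apply, MonoidAlgebra.single_mul_single, inv_mul_cancel_right, mul_one]
    rw [e, mul_smul]
    exact smul_mem_generatedSub (single_mem_groupSubalgebra hlt c)
      (subset_generatedSub (Finset.mem_coe.2 (Finset.mem_image_of_mem _ ht)))
  have hxS : ∀ s ∈ S, x ^ m • s ∈ I.carrier • generatedSub k L (S : Set W) := fun s hs => by
    obtain ⟨t, ht, rfl⟩ := Finset.mem_image.1 hs
    refine Submodule.smul_mono le_rfl hS ?_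
    exact smul_mem_ideal_smul_of_isCentralModulo (pow_mem hx' m) hxc
      (by simpa using hm) (smul_mem_generatedSub (of_mem_groupSubalgebra (hTL ht))
        (subset_generatedSub rfl))
  obtain ⟨n, hn⟩ := exists_pow_smul_mem_ideal_smul hI h.le S (pow_mem hx m) hxc hxS (hS hb)
  exact (mem_annihilatorRadical_iff hA hX hx hxf).2 ⟨m * n, by rwa [pow_mul]⟩

theorem annihilatorRadical_eq_of_le (hA : A ≤ Subgroup.center (N ⧸ I.dagger))
    (hI : Finite (↥K ⧸ I.dagger.subgroupOf K)) (h : IsAdmissible K L) (h' : IsAdmissible K L')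
    (hL : L ≤ L') (a : W) (hX : X ≤ centralPart I L A) (hX' : X ≤ centralPart I L' A) :
    annihilatorRadical I a hX = annihilatorRadical I a hX' :=
  le_antisymm (annihilatorRadical_le_of_le hA hL a hX hX')
    (annihilatorRadical_le_of_mem hA hI h h' hL (subset_generatedSub rfl) hX hX')

/-- The radical of the annihilator does not depend on the dense subgroup. -/
theorem annihilatorRadical_eq (hA : A ≤ Subgroup.center (N ⧸ I.dagger))
    (hI : Finite (↥K ⧸ I.dagger.subgroupOf K)) (h : IsAdmissible K L) (h' : IsAdmissible K L')
    (a : W) (hX : X ≤ centralPart I L A) (hX' : X ≤ centralPart I L' A) :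
    annihilatorRadical I a hX = annihilatorRadical I a hX' :=
  (annihilatorRadical_eq_of_le hA hI (h.inf h') h inf_le_left a
    (le_centralPart_inf h'.le hX hX') hX).symm.trans
      (annihilatorRadical_eq_of_le hA hI (h.inf h') h' inf_le_right a
        (le_centralPart_inf h'.le hX hX') hX')

/-- `r` has finite support, so `r • a ∈ kL'a` for some admissible `L' ≥ L`; go up from `L` to `L'`
with `a`, then down to `L` with `r • a`. -/
theorem annihilatorRadical_le_smul (hA : A ≤ Subgroup.center (N ⧸ I.dagger))
    (hI : Finite (↥K ⧸ I.dagger.subgroupOf K)) (h : IsAdmissible K L) (a : W)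
    (r : MonoidAlgebra k N) (hX : X ≤ centralPart I L A) :
    annihilatorRadical I a hX ≤ annihilatorRadical I (r • a) hX := by
  obtain ⟨L', h', hL, hr⟩ := h.exists_le_of_finset r.coeff.support
  have hrL : r ∈ groupSubalgebra k L' := by
    rw [← MonoidAlgebra.sum_coeff_single r]
    exact sum_mem fun g hg => single_mem_groupSubalgebra (hr hg) _
  have hX' := hX.trans (centralPart_mono hL)
  exact (annihilatorRadical_le_of_le hA hL a hX hX').trans (annihilatorRadical_le_of_mem hA hI h h'
    hL (smul_mem_generatedSub hrL (subset_generatedSub rfl)) hX hX')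

/-- There is a nonzero element whose nonzero multiples have the same radical of the annihilator. -/
theorem exists_forall_annihilatorRadical_eq [Nontrivial W]
    (hA : A ≤ Subgroup.center (N ⧸ I.dagger))
    (hI : Finite (↥K ⧸ I.dagger.subgroupOf K)) (h : IsAdmissible K L) (hXfg : X.FG)
    (hX : X ≤ centralPart I L A) :
    ∃ v : W, v ≠ 0 ∧ ∀ a ∈ Submodule.span (MonoidAlgebra k N) {v}, a ≠ 0 →
      annihilatorRadical I a hX = annihilatorRadical I v hX := by
  have : Group.FG X := (Group.fg_iff_subgroup_fg _).2 hXfg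
  have := isNoetherianRing_monoidAlgebra_of_fg_of_comm (k := k) (Y := X)
  obtain ⟨w, hw⟩ := exists_ne (0 : W)
  -- Passing to a nonzero multiple can only enlarge the radical, so a maximal one stays constant on
  -- the nonzero elements of `kNv`.
  obtain ⟨_, ⟨v, hv, rfl⟩, hmax⟩ := set_has_maximal_iff_noetherian.2 this
    ((fun a : W => annihilatorRadical I a hX) '' {a | a ≠ 0}) ⟨_, w, hw, rfl⟩
  refine ⟨v, hv, fun a ha ha0 => ?_⟩
  obtain ⟨r, rfl⟩ := Submodule.mem_span_singleton.1 ha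
  by_contra hne
  exact hmax _ ⟨_, ha0, rfl⟩
    (lt_of_le_of_ne (annihilatorRadical_le_smul hA hI h v r hX) (Ne.symm hne))

end Radical

/-! ### The main theorem -/

theorem proposition4p1
    {N : Type*} [Group N] (hN_nilpotent : Group.IsNilpotent N)
    (hN_minimax : IsMinimaxGroup N) (hN_torsionFree : GroupIsTorsionFree N)
    (K : Subgroup N) [K.Normal]
    (hNK_comm : ∀ x y : N ⧸ K, x * y = y * x) (hNK_torsionFree : GroupIsTorsionFree (N ⧸ K))
    {k : Type*} [Field k] [CharZero k]
    {W : Type*} [AddCommGroup W] [Nontrivial W] [Module k W]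
    [Module (MonoidAlgebra k N) W] [IsScalarTower k (MonoidAlgebra k N) W]
    (hW : IsTorsionFreeOver W k K)
    (I : InvariantIdeal k K) (hI : I.IsLarge)
    (A : Subgroup (N ⧸ I.dagger)) [IsMulCommutative A]
    (hA_central : A ≤ Subgroup.center (N ⧸ I.dagger)) (hA_torsionFree : GroupIsTorsionFree A)
    (hA_char : A.Characteristic) (hA_finiteIndex : A.FiniteIndex) :
    ∃ V : Submodule (MonoidAlgebra k N) W,
      V ≠ ⊥ ∧ (∃ v : W, V = Submodule.span (MonoidAlgebra k N) {v}) ∧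
      -- the sets in question are defined: the required subgroups `A_L` exist
      (∀ a ∈ V, a ≠ 0 → ∀ L : Subgroup N, IsAdmissible K L →
        ∃ A_L : Subgroup (centralPart I L A), IsStableSubgroup (centralRep I L a A) A_L) ∧
      -- they do not depend on the element, on the dense subgroup, or on the choice of `A_L`
      (∀ a ∈ V, a ≠ 0 → ∀ b ∈ V, b ≠ 0 →
        ∀ L : Subgroup N, IsAdmissible K L → ∀ M : Subgroup N, IsAdmissible K M →
        ∀ A_L : Subgroup (centralPart I L A), IsStableSubgroup (centralRep I L a A) A_L →
        ∀ A_M : Subgroup (centralPart I M A), IsStableSubgroup (centralRep I M b A) A_M →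
          invariantClasses I L a A A_L = invariantClasses I M b A A_M) ∧
      -- so that they define one finite set of classes of prime ideals of `kA`
      (∃! m : Set (Set (PrimeSpectrum (MonoidAlgebra k A))), m.Finite ∧
        ∀ a ∈ V, a ≠ 0 → ∀ L : Subgroup N, IsAdmissible K L →
        ∀ A_L : Subgroup (centralPart I L A), IsStableSubgroup (centralRep I L a A) A_L →
          invariantClasses I L a A A_L = m) := by
  have := hN_nilpotent
  have : IsMulCommutative (N ⧸ K) := ⟨⟨hNK_comm⟩⟩
  have hfin := hI.finite
  obtain ⟨L₀, hL₀⟩ := hN_minimax.exists_isAdmissible (K := K)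
  obtain ⟨v, hv, hrad⟩ := exists_forall_annihilatorRadical_eq (W := W) hA_central hfin hL₀
    (hL₀.fg_centralPart hfin hA_torsionFree) le_rfl
  have hstable : ∀ (a : W) (L : Subgroup N), IsAdmissible K L →
      ∃ C : Subgroup (centralPart I L A), IsStableSubgroup (centralRep I L a A) C := by
    intro a L hL
    have : Group.FG (centralPart I L A) :=
      (Group.fg_iff_subgroup_fg _).2 (hL.fg_centralPart hfin hA_torsionFree)
    exact exists_isStableSubgroup _
  have hindep : ∀ a ∈ Submodule.span (MonoidAlgebra k N) {v}, a ≠ 0 →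
      ∀ b ∈ Submodule.span (MonoidAlgebra k N) {v}, b ≠ 0 →
      ∀ L : Subgroup N, IsAdmissible K L → ∀ M : Subgroup N, IsAdmissible K M →
      ∀ C : Subgroup (centralPart I L A), IsStableSubgroup (centralRep I L a A) C →
      ∀ D : Subgroup (centralPart I M A), IsStableSubgroup (centralRep I M b A) D →
        invariantClasses I L a A C = invariantClasses I M b A D := by
    intro a ha ha0 b hb hb0 L hL M hM C hC D hD
    have hdense : ∀ {L : Subgroup N} {a : W} {C : Subgroup (centralPart I L A)},
        IsAdmissible K L → IsStableSubgroup (centralRep I L a A) C →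
        IsDenseSubgroup (C.map (centralPart I L A).subtype) := by
      intro L a C hL hC g
      obtain ⟨m, hm, hg⟩ := isDenseSubgroup_centralPart (I := I) (A := A) hL.dense g
      obtain ⟨n, hn, hg'⟩ := hC.dense ⟨g ^ m, hg⟩
      exact ⟨m * n, Nat.mul_pos hm hn, _, hg', by rw [pow_mul]; rfl⟩
    -- `X` lies below both stable subgroups, so that both sets of classes can be computed over `kX`,
    -- and below `A ∩ L₀ / I†`, where the radicals are known to be constant.
    set X := C.map (centralPart I L A).subtype ⊓ D.map (centralPart I M A).subtype ⊓
      centralPart I L₀ A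
    have hXC : X ≤ C.map (centralPart I L A).subtype := inf_le_left.trans inf_le_left
    have hXD : X ≤ D.map (centralPart I M A).subtype := inf_le_left.trans inf_le_right
    have hX₀ : X ≤ centralPart I L₀ A := inf_le_right
    have hXL : X ≤ centralPart I L A := hXC.trans (Subgroup.map_subtype_le C)
    have hXM : X ≤ centralPart I M A := hXD.trans (Subgroup.map_subtype_le D)
    have hX : IsDenseSubgroup X :=
      ((hdense hL hC).inf (hdense hM hD)).inf (isDenseSubgroup_centralPart hL₀.dense)
    have hXfg : X.FG := (hL₀.fg_centralPart hfin hA_torsionFree).of_le_of_comm hX₀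
    -- Both radicals are moved from `L` and `M` to `L₀` and written as contractions from `A ∩ L₀ /
    -- I†`, where each equals the radical of `v`.
    have key : annihilatorRadical I a hXL = annihilatorRadical I b hXM := by
      rw [annihilatorRadical_eq hA_central hfin hL hL₀ a hXL hX₀,
        annihilatorRadical_eq hA_central hfin hM hL₀ b hXM hX₀,
        ← annihilatorRadical_comap a le_rfl hX₀, ← annihilatorRadical_comap b le_rfl hX₀,
        hrad a ha ha0, hrad b hb hb0]
    have e₁ := hC.classesOver_eq (hL.finite_asModule hfin hA_finiteIndex a hC.dense) hXfg hX
      hXL hXC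
    have e₂ := hD.classesOver_eq (hM.finite_asModule hfin hA_finiteIndex b hD.dense) hXfg hX
      hXM hXD
    rw [minimalOverAnnihilator_eq] at e₁ e₂
    rw [key] at e₁
    exact e₁.trans e₂.symm
  have hmem : v ∈ Submodule.span (MonoidAlgebra k N) {v} := Submodule.mem_span_singleton_self v
  refine ⟨Submodule.span (MonoidAlgebra k N) {v}, ?_, ⟨v, rfl⟩, fun a _ _ => hstable a, hindep, ?_⟩
  · rwa [Ne, Submodule.span_singleton_eq_bot]
  · obtain ⟨C₀, hC₀⟩ := hstable v L₀ hL₀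
    refine ⟨invariantClasses I L₀ v A C₀, ⟨?_, fun a ha ha0 L hL C hC =>
      hindep a ha ha0 v hmem hv L hL L₀ hL₀ C hC C₀ hC₀⟩, fun m hm => ?_⟩
    · exact hC₀.finite_classesOver (isDenseSubgroup_centralPart hL₀.dense)
        (hL₀.finite_asModule hfin hA_finiteIndex v hC₀.dense)
    · exact (hm.2 v hmem hv L₀ hL₀ C₀ hC₀).symm
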